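/- For a knot $K$ with Seifert matrix $V$ (of even size $2g$), let $\Delta(K)(t)=\det(t^{1/2}V-t^{-1/2}V^T)=t^{-g}\det(tV-V^T)$ be its symmetrized Alexander polynomial, and for $t\in S^1=\{|t|=1\}$ let $\sigma_t(K)$ be the signature (number of positive minus number of negative eigenvalues) of the Hermitian matrix $(1-t)V+(1-\bar t)V^T$. For a root $\rho=e^{i\theta}$ of $\Delta(K)$ on $S^1$ define the jump $$\mathrm{j}_\rho(K)=\lim_{\varphi\to\theta^+}\sigma_{e^{i\varphi}}(K)-\lim_{\varphi\to\theta^-}\sigma_{e^{i\varphi}}(K).$$ For a real analytic function $f$ near $a\in\mathbb R$, let $\operatorname{sgn}(f,a)$ be the sign of the first nonvanishing Taylor coefficient of $f$ at $a$ (and $0$ if there is none); write $\operatorname{sgn}(\Delta(K),\theta)$ for $\operatorname{sgn}(f,\theta)$ with $f(\varphi)=\Delta(K)(e^{i\varphi})$, which is real-valued. **Theorem.** Let $K$ be a knot such that all roots of $\Delta(K)$ on the unit circle are simple, and let $\rho=e^{i\theta}$ be a root of $\Delta(K)$ on the unit circle. Choose a planar projection of $K$ and a crossing of it, let $\epsilon\in\{+1,-1\}$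 be the sign of this crossing, and let $K^+$ and $K^-$ be the knots obtained by making this crossing positive, respectively negative (so that $K=K^{\epsilon}$). Suppose that $\Delta(K^{-\epsilon})(\rho)\neq 0$. Then both one-sided limits of the signature function at $\rho$ exist and $$\mathrm{j}_\rho(K)=2\,\epsilon\,\operatorname{sgn}(\Delta(K^+),\theta)\,\operatorname{sgn}(\Delta(K^-),\theta)\in\{-2,2\}.$$ -/

import Mathlib

open Filter Topology

noncomputable section

/-! ### Oriented knot diagrams -/

/-- The underlying oriented curve of a diagram, with `n` double points.

Rotate the picture at a double point `c` so that both strands run upwards.  The curve then passes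
through `c` twice: the passage `(c, true)` runs from bottom left to top right, the passage
`(c, false)` from bottom right to top left.  `next p` is the passage met immediately after `p` when
one travels along the curve.  The edge of the curve that starts at the passage `p` (and ends at
`next p`) is also called `p`. -/
structure OrientedShadow where
  n : ℕ
  next : Equiv.Perm (Fin n × Bool)

namespace OrientedShadow

variable (S : OrientedShadow)

/-- The edges of the curve, each named by the passage at which it starts. -/
abbrev Edge : Type := Fin S.n × Bool

/-- The edge that arrives at `c` from the bottom left. -/
def inL (c : Fin S.n) : S.Edge := S.next.symm (c, true)

/-- The edge that arrives at `c` from the bottom right. -/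
def inR (c : Fin S.n) : S.Edge := S.next.symm (c, false)

/-- The edge that leaves `c` to the top left. -/
def outL (c : Fin S.n) : S.Edge := (c, false)

/-- The edge that leaves `c` to the top right. -/
def outR (c : Fin S.n) : S.Edge := (c, true)

/-- `(e, true)` is the left side of the edge `e`, and `(e, false)` its right side.  Each of the four
corners at a double point belongs to one region and glues two sides of edges. -/
inductive Corner : S.Edge × Bool → S.Edge × Bool → Prop
  | west (c : Fin S.n) : Corner (S.inL c, true) (S.outL c, true)
  | north (c : Fin S.n) : Corner (S.outL c, false) (S.outR c, true)
  | east (c : Fin S.n) : Corner (S.outR c, false) (S.inR c, false)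
  | south (c : Fin S.n) : Corner (S.inR c, true) (S.inL c, false)

/-- The regions (faces) of the curve: sides of edges, glued at the corners. -/
def Region : Type := Quot S.Corner

end OrientedShadow

/-- A diagram (a regular planar projection with crossing information) of an oriented knot, with at
least one crossing.

* `single`: the curve has a single component.
* `planar`: the 4-valent graph with `n` vertices and `2 n` edges lies on the sphere, that is, it has
  `n + 2` regions (Euler's formula; the surface given by the code is connected by `single`).
* `sign c` is the sign of the crossing `c`.  With both strands running upwards, the over-strand of a
  positive crossing runs from bottom left to top right, and the over-strand of a negative crossing
  runs from bottom right to top left.  So the sign also says which passage is the upper one. -/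
structure KnotDiagram extends OrientedShadow where
  single : ∀ p q : Fin n × Bool, next.SameCycle p q
  planar : Nat.card toOrientedShadow.Region = n + 2
  sign : Fin n → ℤˣ

namespace KnotDiagram

variable (D : KnotDiagram)

/-- The diagram `K^δ` obtained by making the crossing `c` positive (`δ = 1`) or negative
(`δ = -1`). -/
def resolve (c : Fin D.n) (δ : ℤˣ) : KnotDiagram where
  toOrientedShadow := D.toOrientedShadow
  single := D.single
  planar := D.planar
  sign := Function.update D.sign c δ

/-! ### The Seifert surface of a diagram

Smoothing all crossings along the orientation turns the diagram into the disjoint Seifert circles: at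
`c` the edge `inL c` is continued by `outL c`, and `inR c` by `outR c`.  The Seifert surface consists
of a disc for each Seifert circle and a half-twisted band for each crossing.  When every band is
contracted to a point, the surface becomes the graph of the curve with a 2-cell glued to each Seifert
circle, so its first homology is that of this 2-complex. -/

/-- Cellular 1-cycles: integral flows on the edges that are conserved at each crossing. -/
def cycles : Submodule ℤ (D.Edge → ℤ) where
  carrier := {x | ∀ c, x (D.outL c) + x (D.outR c) = x (D.inL c) + x (D.inR c)}
  zero_mem' := by intro c; simp
  add_mem' := by
    intro x y hx hy c
    have h1 := hx c
    have h2 := hy c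
    simp only [Pi.add_apply]
    linarith
  smul_mem' := by
    intro a x hx c
    have h1 := hx c
    simp only [Pi.smul_apply, smul_eq_mul]
    rw [← mul_add, ← mul_add, h1]

/-- The amount of a cycle that runs through the band at each crossing, from the right to the left
Seifert arc. -/
def bandFlow : D.cycles →ₗ[ℤ] (Fin D.n → ℤ) where
  toFun x c := x.1 (D.outL c) - x.1 (D.inL c)
  map_add' := by
    intro x y
    funext c
    simp only [Submodule.coe_add, Pi.add_apply]
    ring
  map_smul' := by
    intro a x
    funext c
    simp only [Submodule.coe_smul, Pi.smul_apply, smul_eq_mul, RingHom.id_apply]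
    ring

/-- The boundaries: the cycles that are constant along each Seifert circle, i.e. the integral
combinations of Seifert circles. -/
def discBoundaries : Submodule ℤ D.cycles := LinearMap.ker D.bandFlow

/-- The first homology group of the Seifert surface. -/
abbrev SeifertH1 : Type := D.cycles ⧸ D.discBoundaries

/-- The linking number `lk(x, y⁺)`, where `y⁺` is `y` pushed off the Seifert surface in the positive
normal direction.

Let the discs be domes standing on the Seifert circles, the outer ones above the inner ones, so that
the surface is a vertical wall over each edge and the bands hang below.  Near the edges the positive
normal points to the right of the edge, so the projections of `x` and `y⁺` meet only at the bands.  At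
a band `x` passes over `y⁺` exactly once, with `x` travelling upwards on the right Seifert arc and
`y⁺` through the band from right to left; this is a positive crossing.  The half-twist puts this
crossing above the end of the band if the crossing of the diagram is positive and below it if it is
negative, so that the arc of `x` involved is `outR c` or `inR c`, respectively. -/
def linking (x y : D.cycles) : ℤ :=
  ∑ c, (if D.sign c = 1 then x.1 (D.outR c) else x.1 (D.inR c)) * D.bandFlow y c

/-- `V` is the matrix `lk(bᵢ, bⱼ⁺)` of the Seifert surface of the diagram for a basis `b` of its first
homology. -/
def IsDiagramSeifertMatrix {m : ℕ} (V : Matrix (Fin m) (Fin m) ℤ) : Prop :=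
  ∃ (b : Module.Basis (Fin m) ℤ D.SeifertH1) (x : Fin m → D.cycles),
    (∀ i, D.discBoundaries.mkQ (x i) = b i) ∧ ∀ i j, V i j = D.linking (x i) (x j)

end KnotDiagram

/-! ### Seifert matrices of a knot -/

/-- The elementary enlargement `[[V, v, 0], [0, 0, 1], [0, 0, 0]]`. -/
def enlargeCol {m : ℕ} (V : Matrix (Fin m) (Fin m) ℤ) (v : Fin m → ℤ) :
    Matrix (Fin (m + 2)) (Fin (m + 2)) ℤ :=
  Matrix.reindex finSumFinEquiv finSumFinEquiv
    (Matrix.fromBlocks V (Matrix.of fun i j => if j = 0 then v i else 0) 0 !![0, 1; 0, 0])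

/-- The elementary enlargement `[[V, 0, 0], [v, 0, 0], [0, 1, 0]]`. -/
def enlargeRow {m : ℕ} (V : Matrix (Fin m) (Fin m) ℤ) (v : Fin m → ℤ) :
    Matrix (Fin (m + 2)) (Fin (m + 2)) ℤ :=
  Matrix.reindex finSumFinEquiv finSumFinEquiv
    (Matrix.fromBlocks V 0 (Matrix.of fun i j => if i = 0 then v j else 0) !![0, 0; 1, 0])

/-- S-equivalence of integral matrices: the equivalence relation generated by unimodular congruence
and elementary enlargements. -/
inductive SEquivalent : ∀ {m k : ℕ}, Matrix (Fin m) (Fin m) ℤ → Matrix (Fin k) (Fin k) ℤ → Prop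
  | congruent {m : ℕ} (V P : Matrix (Fin m) (Fin m) ℤ) (hP : IsUnit P.det) :
      SEquivalent V (P.transpose * V * P)
  | col {m : ℕ} (V : Matrix (Fin m) (Fin m) ℤ) (v : Fin m → ℤ) : SEquivalent V (enlargeCol V v)
  | row {m : ℕ} (V : Matrix (Fin m) (Fin m) ℤ) (v : Fin m → ℤ) : SEquivalent V (enlargeRow V v)
  | symm {m k : ℕ} {V : Matrix (Fin m) (Fin m) ℤ} {W : Matrix (Fin k) (Fin k) ℤ} :
      SEquivalent V W → SEquivalent W V
  | trans {m k l : ℕ} {V : Matrix (Fin m) (Fin m) ℤ} {W : Matrix (Fin k) (Fin k) ℤ}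
      {U : Matrix (Fin l) (Fin l) ℤ} : SEquivalent V W → SEquivalent W U → SEquivalent V U

/-- `V` is a Seifert matrix of the knot with diagram `D`.  Seifert matrices of a knot, from whatever
Seifert surface, are S-equivalent to each other; so every matrix in the S-equivalence class of the
Seifert matrices of the diagram is admitted. -/
def KnotDiagram.IsSeifertMatrix (D : KnotDiagram) {m : ℕ} (V : Matrix (Fin m) (Fin m) ℤ) : Prop :=
  ∃ (k : ℕ) (V₀ : Matrix (Fin k) (Fin k) ℤ), D.IsDiagramSeifertMatrix V₀ ∧ SEquivalent V₀ V

/-- Every knot diagram has a Seifert matrix. -/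
theorem KnotDiagram.exists_isSeifertMatrix (D : KnotDiagram) :
    ∃ (m : ℕ) (V : Matrix (Fin m) (Fin m) ℤ), D.IsSeifertMatrix V := by
  have e : D.SeifertH1 ≃ₗ[ℤ] LinearMap.range D.bandFlow := D.bandFlow.quotKerEquivRange
  obtain ⟨m, b⟩ := Submodule.basisOfPid (Pi.basisFun ℤ (Fin D.n)) (LinearMap.range D.bandFlow)
  let b' : Module.Basis (Fin m) ℤ D.SeifertH1 := b.map e.symm
  choose x hx using fun i => D.discBoundaries.mkQ_surjective (b' i)
  let V : Matrix (Fin m) (Fin m) ℤ := Matrix.of fun i j => D.linking (x i) (x j)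
  refine ⟨m, V, m, V, ⟨b', x, hx, fun i j => rfl⟩, ?_⟩
  have h := SEquivalent.congruent V 1 (by simp)
  simpa using h

/-! ### Alexander polynomial, signature function and jumps -/

open Polynomial in
/-- `det (t V - Vᵀ)`, the Alexander polynomial up to a power of `t`. -/
def alexanderPoly {m : ℕ} (V : Matrix (Fin m) (Fin m) ℤ) : ℤ[X] :=
  ((X : ℤ[X]) • V.map (C : ℤ → ℤ[X]) - (V.map (C : ℤ → ℤ[X])).transpose).det

/-- The value at `t ≠ 0` of the symmetrized Alexander polynomial
`det (t^(1/2) V - t^(-1/2) Vᵀ) = t^(-m/2) det (t V - Vᵀ)`; the size `m` of a Seifert matrix of a knot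
is even. -/
def alexander {m : ℕ} (V : Matrix (Fin m) (Fin m) ℤ) (t : ℂ) : ℂ :=
  t ^ (-((m / 2 : ℕ) : ℤ)) * Polynomial.aeval t (alexanderPoly V)

/-- The Alexander polynomial has only simple roots on the unit circle. -/
def HasSimpleCircleRoots {m : ℕ} (V : Matrix (Fin m) (Fin m) ℤ) : Prop :=
  ∀ ρ : ℂ, ‖ρ‖ = 1 → Polynomial.aeval ρ (alexanderPoly V) = 0 →
    Polynomial.aeval ρ (Polynomial.derivative (alexanderPoly V)) ≠ 0

/-- The matrix `B(t) = (1 - t) V + (1 - t̄) Vᵀ`. -/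
def hermitianForm {m : ℕ} (V : Matrix (Fin m) (Fin m) ℤ) (t : ℂ) : Matrix (Fin m) (Fin m) ℂ :=
  (1 - t) • V.map (Int.cast : ℤ → ℂ) + (1 - star t) • (V.map (Int.cast : ℤ → ℂ)).transpose

theorem hermitianForm_isHermitian {m : ℕ} (V : Matrix (Fin m) (Fin m) ℤ) (t : ℂ) :
    (hermitianForm V t).IsHermitian := by
  ext i j
  simp [hermitianForm, Matrix.conjTranspose_apply, add_comm]

/-- The signature of `B(t)`: the number of positive minus the number of negative eigenvalues. -/
def signatureAt {m : ℕ} (V : Matrix (Fin m) (Fin m) ℤ) (t : ℂ) : ℤ :=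
  ∑ i, (SignType.sign ((hermitianForm_isHermitian V t).eigenvalues i) : ℤ)

/-- The point `e^{iθ}` of the unit circle. -/
def circlePoint (θ : ℝ) : ℂ := Complex.exp (θ * Complex.I)

/-- The integer-valued function `σ` on the unit circle has one-sided limits at `e^{iθ}`, and `j` is
the limit for arguments decreasing to `θ` minus the limit for arguments increasing to `θ`. -/
def HasJump (σ : ℂ → ℤ) (θ : ℝ) (j : ℤ) : Prop :=
  ∃ a b : ℤ, Tendsto (fun φ : ℝ => σ (circlePoint φ)) (𝓝[>] θ) (𝓝 a) ∧
    Tendsto (fun φ : ℝ => σ (circlePoint φ)) (𝓝[<] θ) (𝓝 b) ∧ j = a - b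

open Classical in
/-- The sign of an analytic function `f` at `a`: the sign of its first nonzero Taylor coefficient at
`a`, and zero if there is none. -/
def sgnAt (f : ℝ → ℝ) (a : ℝ) : ℤ :=
  if h : ∃ k : ℕ, iteratedDeriv k f a ≠ 0 then
    (SignType.sign (iteratedDeriv (Nat.find h) f a) : ℤ)
  else 0

/-- The sign at `θ` of `Δ(e^{iφ})` as a function of the real variable `φ`.  The symmetrized Alexander
polynomial is real on the unit circle, so that the real part is the value itself. -/
def alexanderSgn {m : ℕ} (V : Matrix (Fin m) (Fin m) ℤ) (θ : ℝ) : ℤ :=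
  sgnAt (fun φ : ℝ => (alexander V (circlePoint φ)).re) θ

end

/-! A crossing change alters only the half-twist of one band of the Seifert surface of the diagram.
The homology and a basis of it stay the same, and the Seifert matrix `V` of `K` becomes `U = V + ε f
fᵀ`, where `f` records the flow of the basis cycles through that band (`crossingChange`). On the
unit circle `(1 - t) + (1 - t̄) = |1 - t|²`, so the Hermitian form of `U` is that of `V` plus `ε |1
- t|² |f·x|²`.

A semidefinite rank one change moves the positive index by `0` or `1`, and the parity of that index
is read off the sign of the determinant. For even size `2g` the determinant is `(-|1 - t|²)^g Δ(t)`,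
with the same factor for both matrices. Hence `σ(V) = σ(U) - ε (1 - sgn Δ_V · sgn Δ_U)` wherever
both forms are nondegenerate (`signatureAt_rank_one`). Near `ρ` the numbers `σ(U)` and `sgn Δ_U` are
constant, while `Δ_V` changes sign because its root is simple. The difference of the two one-sided
values is the jump.

Arbitrary Seifert matrices are reached through the invariants of S-equivalence
(`SEquivalent.invariants`) and the congruence of all Seifert matrices of one diagram. The congruence
needs disc boundaries to link trivially with every cycle, which rests on planarity. Evenness of the
size follows from the parity of the number of Seifert circles. The point `t = 1`, where the form
vanishes, is never a simple root. -/

noncomputable section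

/-! ### Signatures of Hermitian matrices -/

/-- **Sylvester's law of inertia**, as a dimension count: if `∑ l i |F x i|² ≤ ∑ m j |G x j|²` on
the kernel of `H`, the number of positive weights on the left exceeds that on the right by at most the
number of components of `H`. -/
theorem card_pos_le_of_forall_le {E ι κ τ : Type*} [AddCommGroup E] [Module ℂ E] [Fintype ι]
    [Fintype κ] [Fintype τ] (l : ι → ℝ) (m : κ → ℝ) (F : E ≃ₗ[ℂ] (ι → ℂ)) (G : E →ₗ[ℂ] (κ → ℂ))
    (H : E →ₗ[ℂ] (τ → ℂ))
    (h : ∀ x, H x = 0 → ∑ i, l i * ‖F x i‖ ^ 2 ≤ ∑ j, m j * ‖G x j‖ ^ 2) :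
    Fintype.card {i // 0 < l i} ≤ Fintype.card {j // 0 < m j} + Fintype.card τ := by
  classical
  -- `T` collects the coordinates with nonpositive left weight, those with positive right weight,
  -- and `H`. On its kernel the left sum is nonnegative and the right one nonpositive, so all
  -- coordinates vanish; injectivity gives the count of dimensions.
  let T : (ι → ℂ) →ₗ[ℂ] ({i // ¬ 0 < l i} → ℂ) × ({j // 0 < m j} → ℂ) × (τ → ℂ) :=
    ((LinearMap.funLeft ℂ ℂ Subtype.val ∘ₗ F.toLinearMap).prod
      ((LinearMap.funLeft ℂ ℂ Subtype.val ∘ₗ G).prod H)) ∘ₗ F.symm.toLinearMap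
  have hT : Function.Injective T := by
    rw [← LinearMap.ker_eq_bot, LinearMap.ker_eq_bot']
    intro y hy
    obtain ⟨x, rfl⟩ := F.surjective y
    have h1 : ∀ i, ¬ 0 < l i → F x i = 0 := fun i hi => by
      simpa [T, LinearMap.funLeft] using congrFun (congrArg (fun p => p.1) hy) ⟨i, hi⟩
    have h2 : ∀ j, 0 < m j → G x j = 0 := fun j hj => by
      simpa [T, LinearMap.funLeft] using congrFun (congrArg (fun p => p.2.1) hy) ⟨j, hj⟩
    have h3 : H x = 0 := by
      simpa [T] using congrArg (fun p => p.2.2) hy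
    have h4 : ∑ j, m j * ‖G x j‖ ^ 2 ≤ 0 := by
      refine Finset.sum_nonpos fun j _ => ?_
      by_cases hj : 0 < m j
      · simp [h2 j hj]
      · exact mul_nonpos_of_nonpos_of_nonneg (not_lt.1 hj) (by positivity)
    have h5 : ∀ i ∈ Finset.univ, 0 ≤ l i * ‖F x i‖ ^ 2 := fun i _ => by
      by_cases hi : 0 < l i
      · positivity
      · simp [h1 i hi]
    have h6 := (Finset.sum_eq_zero_iff_of_nonneg h5).1
      (le_antisymm ((h x h3).trans h4) (Finset.sum_nonneg h5))
    funext i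
    by_cases hi : 0 < l i
    · simpa [hi.ne'] using h6 i (Finset.mem_univ i)
    · exact h1 i hi
  have := LinearMap.finrank_le_finrank_of_injective hT
  simp only [Module.finrank_prod, Module.finrank_fintype_fun_eq_card,
    Fintype.card_subtype_compl] at this
  have := Fintype.card_subtype_le (fun i => 0 < l i)
  omega

theorem sum_sign_eq_card {ι : Type*} [Fintype ι] (w : ι → ℝ) :
    ∑ i, (SignType.sign (w i) : ℤ) =
      (Fintype.card {i // 0 < w i} : ℤ) - Fintype.card {i // 0 < (-w) i} := by
  simp only [Fintype.card_subtype, Finset.card_filter, Nat.cast_sum, ← Finset.sum_sub_distrib]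
  refine Finset.sum_congr rfl fun i _ => ?_
  rcases lt_trichotomy (w i) 0 with hi | hi | hi
  · simp [hi, hi.not_gt]
  · simp [hi]
  · simp [hi, hi.not_gt]

/-- The signature of a diagonal form depends only on the form. -/
theorem sum_sign_eq_of_forall_eq {E ι κ : Type*} [AddCommGroup E] [Module ℂ E] [Fintype ι]
    [Fintype κ] (l : ι → ℝ) (m : κ → ℝ) (F : E ≃ₗ[ℂ] (ι → ℂ)) (G : E ≃ₗ[ℂ] (κ → ℂ))
    (h : ∀ x, ∑ i, l i * ‖F x i‖ ^ 2 = ∑ j, m j * ‖G x j‖ ^ 2) :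
    ∑ i, (SignType.sign (l i) : ℤ) = ∑ j, (SignType.sign (m j) : ℤ) := by
  classical
  have h0 : ∀ x, ∑ i, (-l) i * ‖F x i‖ ^ 2 = ∑ j, (-m) j * ‖G x j‖ ^ 2 := by
    simpa using h
  -- No constraint is imposed (`H` has no components). Negating the weights turns the count of
  -- positive ones into a count of negative ones.
  have a := card_pos_le_of_forall_le l m F G.toLinearMap (0 : E →ₗ[ℂ] (Empty → ℂ))
    fun x _ => (h x).le
  have b := card_pos_le_of_forall_le m l G F.toLinearMap (0 : E →ₗ[ℂ] (Empty → ℂ))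
    fun x _ => (h x).ge
  have c := card_pos_le_of_forall_le (-l) (-m) F G.toLinearMap (0 : E →ₗ[ℂ] (Empty → ℂ))
    fun x _ => (h0 x).le
  have d := card_pos_le_of_forall_le (-m) (-l) G F.toLinearMap (0 : E →ₗ[ℂ] (Empty → ℂ))
    fun x _ => (h0 x).ge
  simp only [Fintype.card_empty, add_zero] at a b c d
  rw [sum_sign_eq_card, sum_sign_eq_card]
  omega

namespace Matrix

variable {ι : Type*} [Fintype ι]

/-- The real quadratic form of a Hermitian matrix. -/
def reForm (A : Matrix ι ι ℂ) (x : ι → ℂ) : ℝ := (star x ⬝ᵥ A *ᵥ x).re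

theorem abs_reForm_le (A : Matrix ι ι ℂ) (x : ι → ℂ) :
    |A.reForm x| ≤ (∑ i, ∑ j, ‖A i j‖) * ∑ i, ‖x i‖ ^ 2 := by
  have h1 : |A.reForm x| ≤ ‖star x ⬝ᵥ A *ᵥ x‖ := Complex.abs_re_le_norm _
  refine h1.trans ?_
  have h2 : star x ⬝ᵥ A *ᵥ x = ∑ i, ∑ j, star (x i) * (A i j * x j) := by
    simp [dotProduct, mulVec, Finset.mul_sum]
  rw [h2, Finset.sum_mul]
  refine (norm_sum_le _ _).trans (Finset.sum_le_sum fun i _ => ?_)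
  rw [Finset.sum_mul]
  refine (norm_sum_le _ _).trans (Finset.sum_le_sum fun j _ => ?_)
  have h3 : ∀ k, ‖x k‖ ^ 2 ≤ ∑ i, ‖x i‖ ^ 2 := fun k =>
    Finset.single_le_sum (f := fun i => ‖x i‖ ^ 2) (fun i _ => by positivity) (Finset.mem_univ k)
  rw [norm_mul, norm_mul, norm_star]
  have h4 : ‖x i‖ * ‖x j‖ ≤ ∑ i, ‖x i‖ ^ 2 := by
    nlinarith [h3 i, h3 j, sq_nonneg (‖x i‖ - ‖x j‖)]
  calc _ = ‖A i j‖ * (‖x i‖ * ‖x j‖) := by ring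
    _ ≤ _ := by gcongr

theorem reForm_sub (A B : Matrix ι ι ℂ) (x : ι → ℂ) :
    (A - B).reForm x = A.reForm x - B.reForm x := by
  simp [reForm, sub_mulVec]

variable [DecidableEq ι] {A B : Matrix ι ι ℂ}

namespace IsHermitian

/-- The coordinates with respect to an orthonormal basis of eigenvectors. -/
def eigenCoord (hA : A.IsHermitian) : (ι → ℂ) ≃ₗ[ℂ] (ι → ℂ) :=
  Matrix.toLinearEquiv' (star (hA.eigenvectorUnitary : Matrix ι ι ℂ))
    (((Unitary.toUnits (star hA.eigenvectorUnitary)).isUnit.invertible))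

theorem eigenCoord_apply (hA : A.IsHermitian) (x : ι → ℂ) :
    hA.eigenCoord x = star (hA.eigenvectorUnitary : Matrix ι ι ℂ) *ᵥ x := by
  rfl

theorem sum_norm_eigenCoord (hA : A.IsHermitian) (x : ι → ℂ) :
    ∑ i, ‖hA.eigenCoord x i‖ ^ 2 = ∑ i, ‖x i‖ ^ 2 := by
  have key : ∀ y : ι → ℂ, ((∑ i, ‖y i‖ ^ 2 : ℝ) : ℂ) = star y ⬝ᵥ y := by
    intro y
    simp [dotProduct, Complex.conj_mul']
  apply Complex.ofReal_injective
  rw [key, key, eigenCoord_apply, star_mulVec, ← dotProduct_mulVec, mulVec_mulVec,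
    star_eq_conjTranspose, conjTranspose_conjTranspose, ← star_eq_conjTranspose,
    Unitary.mul_star_self_of_mem (SetLike.coe_mem _), one_mulVec]

theorem reForm_eq (hA : A.IsHermitian) (x : ι → ℂ) :
    A.reForm x = ∑ i, hA.eigenvalues i * ‖hA.eigenCoord x i‖ ^ 2 := by
  apply Complex.ofReal_injective
  have h : star x ⬝ᵥ A *ᵥ x = ∑ i, (hA.eigenvalues i : ℂ) * (‖hA.eigenCoord x i‖ : ℂ) ^ 2 := by
    conv_lhs => rw [hA.spectral_theorem]
    rw [Unitary.conjStarAlgAut_apply, ← mulVec_mulVec, ← mulVec_mulVec, dotProduct_mulVec,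
      ← eigenCoord_apply]
    have : star x ᵥ* (hA.eigenvectorUnitary : Matrix ι ι ℂ) = star (hA.eigenCoord x) := by
      rw [eigenCoord_apply, star_mulVec, star_eq_conjTranspose, conjTranspose_conjTranspose]
    rw [this]
    simp only [dotProduct, mulVec_diagonal, Pi.star_apply, Function.comp, RCLike.star_def,
      ← Complex.conj_mul']
    refine Finset.sum_congr rfl fun i _ => ?_
    simp only [Complex.coe_algebraMap]
    ring
  have h' : star x ⬝ᵥ A *ᵥ x = ((∑ i, hA.eigenvalues i * ‖hA.eigenCoord x i‖ ^ 2 : ℝ) : ℂ) := by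
    rw [h]; push_cast; rfl
  rw [reForm, h', Complex.ofReal_re]

/-- The signature: the number of positive minus the number of negative eigenvalues. -/
def signature (hA : A.IsHermitian) : ℤ := ∑ i, (SignType.sign (hA.eigenvalues i) : ℤ)

/-- The signature can be computed in any diagonalization. -/
theorem signature_eq {κ : Type*} [Fintype κ] (hA : A.IsHermitian) (m : κ → ℝ)
    (G : (ι → ℂ) ≃ₗ[ℂ] (κ → ℂ)) (h : ∀ x, A.reForm x = ∑ j, m j * ‖G x j‖ ^ 2) :
    hA.signature = ∑ j, (SignType.sign (m j) : ℤ) :=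
  sum_sign_eq_of_forall_eq _ _ hA.eigenCoord G fun x => by rw [← hA.reForm_eq, h]

/-- The number of positive eigenvalues. -/
def posIndex (hA : A.IsHermitian) : ℕ := Fintype.card {i // 0 < hA.eigenvalues i}

/-- Nondegeneracy excludes zero eigenvalues, so the positive index determines the negative one. -/
theorem signature_eq_posIndex (hA : A.IsHermitian) (hd : A.det ≠ 0) :
    hA.signature = 2 * hA.posIndex - Fintype.card ι := by
  have h0 : ∀ i, hA.eigenvalues i ≠ 0 := fun i h => hd (by
    rw [hA.det_eq_prod_eigenvalues]
    exact Finset.prod_eq_zero (Finset.mem_univ i) (by simp [h]))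
  have : (Fintype.card ι : ℤ) = ∑ _i : ι, 1 := by simp
  rw [this]
  simp only [signature, posIndex, Fintype.card_subtype, Finset.card_filter, Nat.cast_sum,
    Finset.mul_sum, ← Finset.sum_sub_distrib]
  refine Finset.sum_congr rfl fun i _ => ?_
  rcases (h0 i).lt_or_gt with hi | hi
  · simp [hi, hi.not_gt]
  · simp [hi]

/-- The sign is `(-1)` to the number of negative eigenvalues, which is the size minus the positive
index; modulo 2 this is their sum. -/
theorem sign_det (hA : A.IsHermitian) (hd : A.det ≠ 0) :
    (SignType.sign A.det.re : ℤ) = (-1) ^ (Fintype.card ι + hA.posIndex) := by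
  have h0 : ∀ i, hA.eigenvalues i ≠ 0 := fun i h => hd (by
    rw [hA.det_eq_prod_eigenvalues]
    exact Finset.prod_eq_zero (Finset.mem_univ i) (by simp [h]))
  have h1 : A.det.re = ∏ i, hA.eigenvalues i := by
    rw [hA.det_eq_prod_eigenvalues]
    have : ∏ i, (hA.eigenvalues i : ℂ) = ((∏ i, hA.eigenvalues i : ℝ) : ℂ) := by push_cast; rfl
    exact (congrArg Complex.re this).trans (Complex.ofReal_re _)
  have h2 : (-1 : ℤ) ^ hA.posIndex = ∏ i, if 0 < hA.eigenvalues i then (-1 : ℤ) else 1 := by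
    rw [posIndex, Fintype.card_subtype, Finset.prod_ite]
    simp
  have h3 : (SignType.sign (∏ i, hA.eigenvalues i) : ℤ) =
      ∏ i, (SignType.sign (hA.eigenvalues i) : ℤ) := by
    induction (Finset.univ : Finset ι) using Finset.induction_on with
    | empty => simp
    | insert i t hi ih => rw [Finset.prod_insert hi, Finset.prod_insert hi, sign_mul,
        SignType.coe_mul, ih]
  rw [h1, h3, pow_add, h2, ← Finset.card_univ, ← Finset.prod_const, ← Finset.prod_mul_distrib]
  refine Finset.prod_congr rfl fun i _ => ?_
  rcases (h0 i).lt_or_gt with hi | hi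
  · simp [hi, hi.not_gt]
  · simp [hi]

/-- A nonnegative rank one perturbation changes the signature of a nondegenerate form by `0` or `2`,
according to the signs of the determinants. -/
theorem signature_add_rank_one (hA : A.IsHermitian) (hB : B.IsHermitian) (hdA : A.det ≠ 0)
    (hdB : B.det ≠ 0) (f : (ι → ℂ) →ₗ[ℂ] ℂ) (s : ℝ) (hs : 0 ≤ s)
    (h : ∀ x, B.reForm x = A.reForm x + s * ‖f x‖ ^ 2) :
    hB.signature = hA.signature + 1 -
      (SignType.sign A.det.re : ℤ) * (SignType.sign B.det.re : ℤ) := by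
  have h1 : hA.posIndex ≤ hB.posIndex + 0 := by
    refine card_pos_le_of_forall_le (τ := Empty) _ _ hA.eigenCoord hB.eigenCoord.toLinearMap 0
      fun x _ => ?_
    have := h x
    rw [hA.reForm_eq, hB.reForm_eq] at this
    have : 0 ≤ s * ‖f x‖ ^ 2 := by positivity
    simp only [LinearEquiv.coe_coe]
    linarith
  -- The two forms agree on the hyperplane `f = 0`, a single linear condition.
  have h2 : hB.posIndex ≤ hA.posIndex + 1 := by
    refine card_pos_le_of_forall_le (τ := Unit) _ _ hB.eigenCoord hA.eigenCoord.toLinearMap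
      (LinearMap.pi fun _ => f) fun x hx => ?_
    have := h x
    rw [hA.reForm_eq, hB.reForm_eq] at this
    have h0 : f x = 0 := congrFun hx ()
    simp only [h0, norm_zero, LinearEquiv.coe_coe] at this ⊢
    linarith
  rw [hA.signature_eq_posIndex hdA, hB.signature_eq_posIndex hdB, hA.sign_det hdA,
    hB.sign_det hdB, ← pow_add]
  obtain h3 | h3 : hB.posIndex = hA.posIndex ∨ hB.posIndex = hA.posIndex + 1 := by omega
  · rw [h3, Even.neg_one_pow ⟨_, rfl⟩]; ring
  · rw [h3, Odd.neg_one_pow ⟨Fintype.card ι + hA.posIndex, by ring⟩]; push_cast; ring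

end IsHermitian

/-- The signature of a continuous family is locally constant where the form is nondegenerate. -/
theorem eventually_signature_eq {X : Type*} [TopologicalSpace X] (M : X → Matrix ι ι ℂ)
    (hM : ∀ t, (M t).IsHermitian) (a : X) (hc : ContinuousAt M a) (hd : (M a).det ≠ 0) :
    ∀ᶠ t in 𝓝 a, (hM t).signature = (hM a).signature := by
  have h0 : ∀ i, (hM a).eigenvalues i ≠ 0 := fun i h => hd (by
    rw [(hM a).det_eq_prod_eigenvalues]
    exact Finset.prod_eq_zero (Finset.mem_univ i) (by simp [h]))
  -- With `δ` below every `|λ i|`, shifting the eigenvalues at `a` by `±δ` changes no sign. In an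
  -- orthonormal eigenbasis such a shift adds `±δ ‖x‖²`, which dominates a small perturbation of the
  -- form.
  obtain ⟨δ, hδ, hδ'⟩ : ∃ δ : ℝ, 0 < δ ∧ ∀ i, δ < |(hM a).eigenvalues i| := by
    have : ∀ᶠ δ in 𝓝[>] (0 : ℝ), 0 < δ ∧ ∀ i, δ < |(hM a).eigenvalues i| := by
      refine eventually_mem_nhdsWithin.and (eventually_all.2 fun i => ?_)
      exact nhdsWithin_le_nhds (eventually_lt_nhds (abs_pos.2 (h0 i)))
    exact this.exists
  have h1 : ∀ᶠ t in 𝓝 a, ∑ i, ∑ j, ‖(M t - M a) i j‖ < δ := by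
    have hcont : ContinuousAt (fun t => ∑ i, ∑ j, ‖(M t - M a) i j‖) a := by
      refine tendsto_finsetSum _ fun i _ => tendsto_finsetSum _ fun j _ => ?_
      have : ContinuousAt (fun t => M t i j) a :=
        continuousAt_pi.1 (continuousAt_pi.1 hc i) j
      exact (this.sub continuousAt_const).norm
    refine hcont.eventually_lt continuousAt_const ?_
    simpa using hδ
  have h2 : ∀ᶠ t in 𝓝 a, (M t).det ≠ 0 := by
    have : ContinuousAt (fun t => (M t).det) a :=
      (Continuous.matrix_det continuous_id).continuousAt.comp hc
    exact this.eventually_ne hd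
  filter_upwards [h1, h2] with t ht htd
  have h3 : ∀ x, |(M t).reForm x - (M a).reForm x| ≤ δ * ∑ i, ‖x i‖ ^ 2 := fun x => by
    rw [← reForm_sub]
    refine (abs_reForm_le _ _).trans ?_
    gcongr
  have h4 : (hM a).posIndex ≤ (hM t).posIndex := by
    have := card_pos_le_of_forall_le (τ := Empty) (fun i => (hM a).eigenvalues i - δ) _
      (hM a).eigenCoord (hM t).eigenCoord.toLinearMap 0 fun x _ => by
        simp only [LinearEquiv.coe_coe, sub_mul, Finset.sum_sub_distrib, ← Finset.mul_sum,
          (hM a).sum_norm_eigenCoord]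
        rw [← (hM a).reForm_eq, ← (hM t).reForm_eq]
        linarith [(abs_le.1 (h3 x)).1]
    refine le_trans (Fintype.card_subtype_mono _ _ fun i hi => ?_) this
    have := hδ' i
    rw [abs_of_pos hi] at this
    exact sub_pos.2 this
  have h5 : (hM t).posIndex ≤ (hM a).posIndex := by
    have := card_pos_le_of_forall_le (τ := Empty) _ (fun i => (hM a).eigenvalues i + δ)
      (hM t).eigenCoord (hM a).eigenCoord.toLinearMap 0 fun x _ => by
        simp only [LinearEquiv.coe_coe, add_mul, Finset.sum_add_distrib, ← Finset.mul_sum,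
          (hM a).sum_norm_eigenCoord]
        rw [← (hM a).reForm_eq, ← (hM t).reForm_eq]
        linarith [(abs_le.1 (h3 x)).2]
    refine this.trans (Fintype.card_subtype_mono _ _ fun i hi => ?_)
    by_contra hn
    have := hδ' i
    rw [abs_of_nonpos (not_lt.1 hn)] at this
    have hi' : 0 < (hM a).eigenvalues i + δ := hi
    linarith
  rw [(hM t).signature_eq_posIndex htd, (hM a).signature_eq_posIndex hd, le_antisymm h5 h4]

end Matrix

/-! ### Invariance under S-equivalence -/

section Evaluation

variable {m : ℕ}

theorem aeval_alexanderPoly (V : Matrix (Fin m) (Fin m) ℤ) (t : ℂ) :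
    Polynomial.aeval t (alexanderPoly V) =
      (t • V.map (Int.cast : ℤ → ℂ) - (V.map (Int.cast : ℤ → ℂ)).transpose).det := by
  rw [alexanderPoly, AlgHom.map_det]
  congr 1
  ext i j
  simp

theorem aeval_alexanderPoly_transpose (V : Matrix (Fin m) (Fin m) ℤ) (t : ℂ) :
    Polynomial.aeval t (alexanderPoly V.transpose) = Polynomial.aeval t (alexanderPoly V) := by
  rw [aeval_alexanderPoly, aeval_alexanderPoly, ← Matrix.det_transpose]
  congr 1

theorem hermitianForm_transpose (V : Matrix (Fin m) (Fin m) ℤ) (t : ℂ) :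
    hermitianForm V.transpose t = hermitianForm V (star t) := by
  simp [hermitianForm, add_comm, Matrix.transpose_map]

theorem Matrix.IsHermitian.signature_congr {ι : Type*} [Fintype ι] [DecidableEq ι]
    {A B : Matrix ι ι ℂ} (hA : A.IsHermitian) (hB : B.IsHermitian) (h : A = B) :
    hA.signature = hB.signature := by
  subst h; rfl

theorem signatureAt_eq_signature (V : Matrix (Fin m) (Fin m) ℤ) (t : ℂ) :
    signatureAt V t = (hermitianForm_isHermitian V t).signature := rfl

theorem signatureAt_transpose (V : Matrix (Fin m) (Fin m) ℤ) (t : ℂ) :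
    signatureAt V.transpose t = signatureAt V (star t) :=
  Matrix.IsHermitian.signature_congr _ _ (hermitianForm_transpose V t)

theorem alexander_transpose (V : Matrix (Fin m) (Fin m) ℤ) (t : ℂ) :
    alexander V.transpose t = alexander V t := by
  rw [alexander, alexander, aeval_alexanderPoly_transpose]

theorem map_intCast_congruent (V P : Matrix (Fin m) (Fin m) ℤ) :
    (P.transpose * V * P).map (Int.cast : ℤ → ℂ) = (P.map (Int.cast : ℤ → ℂ)).transpose *
      V.map (Int.cast : ℤ → ℂ) * P.map (Int.cast : ℤ → ℂ) := by
  change (P.transpose * V * P).map (Int.castRingHom ℂ) = _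
  rw [Matrix.map_mul, Matrix.map_mul, Matrix.transpose_map]
  rfl

/-- The determinant of `P` is `±1` and enters squared. -/
theorem alexander_congruent (V P : Matrix (Fin m) (Fin m) ℤ) (hP : IsUnit P.det) (t : ℂ) :
    alexander (P.transpose * V * P) t = alexander V t := by
  have h : t • (P.transpose * V * P).map (Int.cast : ℤ → ℂ) -
      ((P.transpose * V * P).map (Int.cast : ℤ → ℂ)).transpose =
      (P.map (Int.cast : ℤ → ℂ)).transpose *
        (t • V.map (Int.cast : ℤ → ℂ) - (V.map (Int.cast : ℤ → ℂ)).transpose) *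
        P.map (Int.cast : ℤ → ℂ) := by
    rw [map_intCast_congruent]
    simp [Matrix.mul_sub, Matrix.sub_mul, Matrix.transpose_mul, Matrix.mul_assoc]
  have h2 : (P.map (Int.cast : ℤ → ℂ)).det * (P.map (Int.cast : ℤ → ℂ)).det = 1 := by
    have : (P.map (Int.cast : ℤ → ℂ)).det = ((P.det : ℤ) : ℂ) :=
      ((Int.castRingHom ℂ).map_det P).symm
    rw [this]
    exact_mod_cast Int.isUnit_mul_self hP
  rw [alexander, alexander, aeval_alexanderPoly, aeval_alexanderPoly, h, Matrix.det_mul,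
    Matrix.det_mul, Matrix.det_transpose, mul_right_comm, h2, one_mul]

/-- An integral `P` has `Pᴴ = Pᵀ`, so congruence is a linear change of variables in the Hermitian
form. -/
theorem signatureAt_congruent (V P : Matrix (Fin m) (Fin m) ℤ) (hP : IsUnit P.det) (t : ℂ) :
    signatureAt (P.transpose * V * P) t = signatureAt V t := by
  set Q : Matrix (Fin m) (Fin m) ℂ := P.map (Int.cast : ℤ → ℂ) with hQ
  have hstar : Q.conjTranspose = Q.transpose := by
    ext i j
    simp [hQ]
  have h : hermitianForm (P.transpose * V * P) t = Q.conjTranspose * hermitianForm V t * Q := by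
    rw [hstar, hermitianForm, hermitianForm, map_intCast_congruent, ← hQ]
    simp [Matrix.mul_add, Matrix.add_mul, Matrix.transpose_mul, Matrix.mul_assoc]
  have hu : IsUnit Q := by
    rw [Matrix.isUnit_iff_isUnit_det]
    have : Q.det = Int.castRingHom ℂ P.det := ((Int.castRingHom ℂ).map_det P).symm
    rw [this]
    exact hP.map _
  let e : (Fin m → ℂ) ≃ₗ[ℂ] (Fin m → ℂ) := Matrix.toLinearEquiv' Q hu.invertible
  have he : ∀ x, e x = Q.mulVec x := fun x => rfl
  rw [signatureAt_eq_signature]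
  refine Matrix.IsHermitian.signature_eq _ (hermitianForm_isHermitian V t).eigenvalues
    (e.trans (hermitianForm_isHermitian V t).eigenCoord) fun x => ?_
  rw [h]
  simp only [LinearEquiv.trans_apply, ← (hermitianForm_isHermitian V t).reForm_eq, he,
    Matrix.reForm]
  rw [Matrix.star_mulVec, ← Matrix.mulVec_mulVec, ← Matrix.mulVec_mulVec,
    Matrix.dotProduct_mulVec]

end Evaluation

section Enlargement

variable {m : ℕ} (V : Matrix (Fin m) (Fin m) ℤ) (v : Fin m → ℤ)

/-- Reduces row enlargements to column enlargements: transposition preserves the Alexander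
polynomial and conjugates the parameter of the signature. -/
theorem enlargeRow_eq : enlargeRow V v = (enlargeCol V.transpose v).transpose := by
  rw [enlargeRow, enlargeCol, Matrix.reindex_apply, Matrix.reindex_apply,
    Matrix.transpose_submatrix, Matrix.fromBlocks_transpose]
  congr 2
  ext i j
  fin_cases i <;> fin_cases j <;> rfl

/-- Take the Schur complement of the new block, whose determinant is `t`. The correction vanishes
because `v` meets only the zero diagonal entry of the inverse block. The factor `t` is absorbed by
the normalizing exponent, as `(m + 2) / 2 = m / 2 + 1`. -/
theorem alexander_enlargeCol {t : ℂ} (ht : t ≠ 0) :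
    alexander (enlargeCol V v) t = alexander V t := by
  have h : t • (enlargeCol V v).map (Int.cast : ℤ → ℂ) -
      ((enlargeCol V v).map (Int.cast : ℤ → ℂ)).transpose =
      Matrix.reindex finSumFinEquiv finSumFinEquiv (Matrix.fromBlocks
        (t • V.map (Int.cast : ℤ → ℂ) - (V.map (Int.cast : ℤ → ℂ)).transpose)
        (Matrix.of fun i j => if j = 0 then t * (v i : ℂ) else 0)
        (Matrix.of fun i j => if i = 0 then -(v j : ℂ) else 0) !![0, t; -1, 0]) := by
    ext i j
    obtain ⟨i, rfl⟩ := finSumFinEquiv.surjective i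
    obtain ⟨j, rfl⟩ := finSumFinEquiv.surjective j
    rcases i with i | i <;> rcases j with j | j
    · simp [enlargeCol]
    · fin_cases j <;> simp [enlargeCol]
    · fin_cases i <;> simp [enlargeCol]
    · fin_cases i <;> fin_cases j <;> simp [enlargeCol]
  have hdet : (!![0, t; -1, 0] : Matrix (Fin 2) (Fin 2) ℂ).det = t := by simp
  let inv : Invertible (!![0, t; -1, 0] : Matrix (Fin 2) (Fin 2) ℂ) :=
    ⟨!![0, -1; t⁻¹, 0], by ext i j; fin_cases i <;> fin_cases j <;> simp [ht],
      by ext i j; fin_cases i <;> fin_cases j <;> simp [ht]⟩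
  have hS : (Matrix.of fun (i : Fin m) (j : Fin 2) => if j = 0 then t * (v i : ℂ) else 0) *
      ⅟(!![0, t; -1, 0] : Matrix (Fin 2) (Fin 2) ℂ) *
      (Matrix.of fun (i : Fin 2) (j : Fin m) => if i = 0 then -(v j : ℂ) else 0) = 0 := by
    have hinv : ⅟(!![0, t; -1, 0] : Matrix (Fin 2) (Fin 2) ℂ) = !![0, -1; t⁻¹, 0] := rfl
    rw [hinv]
    ext i j
    simp [Matrix.mul_apply]
  rw [alexander, alexander, aeval_alexanderPoly, aeval_alexanderPoly, h, Matrix.det_reindex_self,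
    Matrix.det_fromBlocks₂₂, hS, sub_zero, hdet, ← mul_assoc]
  congr 1
  rw [← zpow_add_one₀ ht]
  congr 1
  omega

/-- The enlargement adds a hyperbolic plane: the new terms are `2 Re(x̄₀ c(x)) = ½|x₀ + c|² - ½|x₀ -
c|²`, of signature zero. Since `t ≠ 1`, the last coordinate occurs in `c` with nonzero coefficient,
so these are genuine new coordinates. -/
theorem signatureAt_enlargeCol {t : ℂ} (ht : t ≠ 1) :
    signatureAt (enlargeCol V v) t = signatureAt V t := by
  let M := Matrix.fromBlocks (hermitianForm V t)
    (Matrix.of fun (i : Fin m) (j : Fin 2) => if j = 0 then (1 - t) * (v i : ℂ) else 0)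
    (Matrix.of fun (i : Fin 2) (j : Fin m) => if i = 0 then (1 - star t) * (v j : ℂ) else 0)
    !![0, 1 - t; 1 - star t, 0]
  have h : hermitianForm (enlargeCol V v) t = Matrix.reindex finSumFinEquiv finSumFinEquiv M := by
    ext i j
    obtain ⟨i, rfl⟩ := finSumFinEquiv.surjective i
    obtain ⟨j, rfl⟩ := finSumFinEquiv.surjective j
    rcases i with i | i <;> rcases j with j | j
    · simp [enlargeCol, hermitianForm, M]
    · fin_cases j <;> simp [enlargeCol, hermitianForm, M]
    · fin_cases i <;> simp [enlargeCol, hermitianForm, M]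
    · fin_cases i <;> fin_cases j <;> simp [enlargeCol, hermitianForm, M]
  have ht' : 1 - t ≠ 0 := sub_ne_zero.2 ht.symm
  let F := (hermitianForm_isHermitian V t).eigenCoord
  let c : (Fin m ⊕ Fin 2 → ℂ) →ₗ[ℂ] ℂ :=
    { toFun := fun x => (1 - star t) * ∑ j, (v j : ℂ) * x (Sum.inl j) + (1 - t) * x (Sum.inr 1)
      map_add' := fun x y => by
        simp only [Pi.add_apply, mul_add, Finset.sum_add_distrib]; ring
      map_smul' := fun a x => by
        simp only [Pi.smul_apply, smul_eq_mul, RingHom.id_apply, mul_add, Finset.mul_sum]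
        congr 1
        · exact Finset.sum_congr rfl fun i _ => by ring
        · ring }
  let T : (Fin m ⊕ Fin 2 → ℂ) →ₗ[ℂ] (Fin m ⊕ Fin 2 → ℂ) :=
    { toFun := fun x => Sum.elim (F (x ∘ Sum.inl)) ![x (Sum.inr 0) + c x, x (Sum.inr 0) - c x]
      map_add' := fun x y => by
        funext i
        rcases i with i | i
        · have : (x + y) ∘ Sum.inl = x ∘ Sum.inl + y ∘ (Sum.inl : Fin m → Fin m ⊕ Fin 2) := rfl
          simp [this]
        · fin_cases i <;> simp <;> ring
      map_smul' := fun a x => by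
        funext i
        rcases i with i | i
        · have : (a • x) ∘ Sum.inl = a • (x ∘ (Sum.inl : Fin m → Fin m ⊕ Fin 2)) := rfl
          simp [this]
        · fin_cases i <;> simp <;> ring }
  have hT : Function.Injective T := by
    rw [← LinearMap.ker_eq_bot, LinearMap.ker_eq_bot']
    intro x hx
    have h1 : F (x ∘ Sum.inl) = 0 := funext fun i => congrFun hx (Sum.inl i)
    have h2 : x (Sum.inr 0) + c x = 0 := congrFun hx (Sum.inr 0)
    have h3 : x (Sum.inr 0) - c x = 0 := congrFun hx (Sum.inr 1)
    have h4 : ∀ i, x (Sum.inl i) = 0 := congrFun (F.map_eq_zero_iff.1 h1)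
    have h5 : x (Sum.inr 0) = 0 := by linear_combination (h2 + h3) / 2
    have h6 : c x = 0 := by linear_combination (h2 - h3) / 2
    have h7 : x (Sum.inr 1) = 0 := by simpa [c, h4, ht'] using h6
    funext i
    rcases i with i | i
    · exact h4 i
    · fin_cases i
      · exact h5
      · exact h7
  let e : (Fin (m + 2) → ℂ) ≃ₗ[ℂ] (Fin m ⊕ Fin 2 → ℂ) := LinearEquiv.funCongrLeft ℂ ℂ finSumFinEquiv
  have hform : ∀ x : Fin m ⊕ Fin 2 → ℂ, M.reForm x = (hermitianForm V t).reForm (x ∘ Sum.inl) +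
      2 * (star (x (Sum.inr 0)) * c x).re := by
    intro x
    have h1 : star x ⬝ᵥ M.mulVec x =
        star (x ∘ Sum.inl) ⬝ᵥ (hermitianForm V t).mulVec (x ∘ Sum.inl) +
        (star (x (Sum.inr 0)) * c x + star (star (x (Sum.inr 0)) * c x)) := by
      have hM : M.mulVec x = _ := Matrix.fromBlocks_mulVec _ _ _ _ x
      rw [hM]
      have hc : star (c x) = (1 - t) * ∑ j, (v j : ℂ) * star (x (Sum.inl j)) +
          (1 - star t) * star (x (Sum.inr 1)) := by
        simp [c]
      rw [star_mul', hc]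
      simp only [dotProduct, Fintype.sum_sum_type, Fin.sum_univ_two, Sum.elim_inl, Sum.elim_inr,
        Pi.star_apply, Function.comp_apply, Pi.add_apply, mul_add, Finset.sum_add_distrib,
        Matrix.mulVec, Matrix.of_apply, c, LinearMap.coe_mk, AddHom.coe_mk, Finset.mul_sum]
      simp
      have : ∑ i, (starRingEnd ℂ) (x (Sum.inl i)) * ((1 - t) * (v i : ℂ) * x (Sum.inr 0)) =
        ∑ i, x (Sum.inr 0) * ((1 - t) * ((v i : ℂ) * (starRingEnd ℂ) (x (Sum.inl i)))) :=
        Finset.sum_congr rfl fun i _ => by ring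
      rw [this]
      simp only [mul_assoc]
      ring
    rw [Matrix.reForm, h1, Matrix.reForm, Complex.add_re, Complex.add_re, Complex.star_def,
      Complex.conj_re]
    ring
  rw [signatureAt_eq_signature, Matrix.IsHermitian.signature_eq _
    (Sum.elim (hermitianForm_isHermitian V t).eigenvalues ![1 / 2, -1 / 2])
    (e.trans (LinearEquiv.ofInjectiveEndo T hT))]
  · have h1 : SignType.sign (-1 / 2 : ℝ) = -1 := sign_neg (by norm_num)
    have h2 : SignType.sign (1 / 2 : ℝ) = 1 := sign_pos (by norm_num)
    simp only [Fintype.sum_sum_type, Fin.sum_univ_two, Sum.elim_inl, Sum.elim_inr,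
      Matrix.cons_val_zero, Matrix.cons_val_one, h1, h2]
    simp [signatureAt]
  · intro x
    have h1 : (hermitianForm (enlargeCol V v) t).reForm x = M.reForm (e x) := by
      rw [h, Matrix.reForm, Matrix.reForm, Matrix.reindex_apply, Matrix.submatrix_mulVec_equiv]
      congr 1
      exact (dotProduct_comp_equiv_symm _ _ _).trans rfl
    have h2 : ∀ a b : ℂ, 2 * (star a * b).re = 1 / 2 * ‖a + b‖ ^ 2 + -1 / 2 * ‖a - b‖ ^ 2 := by
      intro a b
      rw [← Complex.normSq_eq_norm_sq, ← Complex.normSq_eq_norm_sq]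
      simp [Complex.normSq_apply]
      ring
    rw [h1, hform, h2, (hermitianForm_isHermitian V t).reForm_eq]
    simp [Fintype.sum_sum_type, Fin.sum_univ_two, T, F]

end Enlargement

/-- Parity of the size, Alexander polynomial and signature function are invariants of
S-equivalence. -/
theorem SEquivalent.invariants {m k : ℕ} {V : Matrix (Fin m) (Fin m) ℤ}
    {W : Matrix (Fin k) (Fin k) ℤ} (h : SEquivalent V W) :
    (Even m ↔ Even k) ∧ (∀ t : ℂ, t ≠ 0 → alexander V t = alexander W t) ∧
      ∀ t : ℂ, t ≠ 1 → signatureAt V t = signatureAt W t := by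
  induction h with
  | congruent V P hP =>
    exact ⟨Iff.rfl, fun t _ => (alexander_congruent V P hP t).symm,
      fun t _ => (signatureAt_congruent V P hP t).symm⟩
  | col V v =>
    exact ⟨by simp [Nat.even_add], fun t ht => (alexander_enlargeCol V v ht).symm,
      fun t ht => (signatureAt_enlargeCol V v ht).symm⟩
  | row V v =>
    refine ⟨by simp [Nat.even_add], fun t ht => ?_, fun t ht => ?_⟩
    · rw [enlargeRow_eq, alexander_transpose, alexander_enlargeCol _ _ ht, alexander_transpose]
    · have ht' : star t ≠ 1 := fun h => ht (by rw [← star_star t, h, star_one])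
      rw [enlargeRow_eq, signatureAt_transpose, signatureAt_enlargeCol _ _ ht',
        signatureAt_transpose, star_star]
  | symm _ ih => exact ⟨ih.1.symm, fun t ht => (ih.2.1 t ht).symm, fun t ht => (ih.2.2 t ht).symm⟩
  | trans _ _ ih₁ ih₂ =>
    exact ⟨ih₁.1.trans ih₂.1, fun t ht => (ih₁.2.1 t ht).trans (ih₂.2.1 t ht),
      fun t ht => (ih₁.2.2 t ht).trans (ih₂.2.2 t ht)⟩

/-! ### Permutations -/

theorem LinearMap.finrank_range_add_finrank_ker_of_isDomain {R M N : Type*} [CommRing R]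
    [IsDomain R] [AddCommGroup M] [AddCommGroup N] [Module R M] [Module R N] [Module.Finite R M]
    (f : M →ₗ[R] N) :
    Module.finrank R (LinearMap.range f) + Module.finrank R (LinearMap.ker f) =
      Module.finrank R M := by
  rw [← f.quotKerEquivRange.finrank_eq, Submodule.finrank_quotient_add_finrank]

namespace Equiv.Perm

variable {α : Type*} (f : Perm α)

theorem SameCycle.apply_eq_of_comp_eq {f : Perm α} {β : Type*} {F : α → β} (hF : ∀ a, F (f a) = F a)
    {a b : α} (h : f.SameCycle a b) : F a = F b := by
  obtain ⟨i, rfl⟩ := h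
  have hF' : ∀ a, F (f⁻¹ a) = F a := fun a => by
    rw [← hF]; exact congrArg F (f.apply_symm_apply a)
  induction i using Int.induction_on generalizing a with
  | zero => rfl
  | succ i ih => rw [zpow_add_one, Perm.mul_apply, ← ih, hF]
  | pred i ih => rw [zpow_sub_one, Perm.mul_apply, ← ih, hF']

/-- The integral functions that are constant on the cycles of a permutation. -/
def invariantFunctions : Submodule ℤ (α → ℤ) where
  carrier := {h | ∀ a, h (f a) = h a}
  zero_mem' := fun _ => rfl
  add_mem' := fun hx hy a => by simp only [Pi.add_apply, hx a, hy a]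
  smul_mem' := fun r x hx a => by simp only [Pi.smul_apply, hx a]

variable [Fintype α] [DecidableEq α]

/-- The sign of a permutation in terms of its number of cycles. -/
theorem sign_eq_finrank_invariantFunctions :
    sign f = (-1 : ℤˣ) ^ (Fintype.card α + Module.finrank ℤ f.invariantFunctions) := by
  -- `p` sends a point to its cycle, fixed points being counted separately. Its fibres are the
  -- cycles, so invariant functions are exactly the functions on its target.
  let p : α → f.cycleFactorsFinset ⊕ {a // ¬ a ∈ f.support} := fun a =>
    if h : a ∈ f.support then Sum.inl ⟨f.cycleOf a, cycleOf_mem_cycleFactorsFinset_iff.2 h⟩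
    else Sum.inr ⟨a, h⟩
  have p_inl : ∀ a (h : a ∈ f.support),
      p a = Sum.inl ⟨f.cycleOf a, cycleOf_mem_cycleFactorsFinset_iff.2 h⟩ := fun a h => dif_pos h
  have p_inr : ∀ a (h : ¬ a ∈ f.support), p a = Sum.inr ⟨a, h⟩ := fun a h => dif_neg h
  have hp : Function.Surjective p := by
    rintro (⟨c, hc⟩ | ⟨a, ha⟩)
    · obtain ⟨a, ha⟩ := ((mem_cycleFactorsFinset_iff.1 hc).1).nonempty_support
      have hca := cycle_is_cycleOf ha hc
      refine ⟨a, ?_⟩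
      rw [p_inl a (mem_cycleFactorsFinset_support_le hc ha)]
      simp [hca.symm]
    · exact ⟨a, p_inr a ha⟩
  have hpf : ∀ a, p (f a) = p a := by
    intro a
    by_cases h : a ∈ f.support
    · rw [p_inl a h, p_inl (f a) (apply_mem_support.2 h)]
      congr 2
      exact (SameCycle.cycleOf_eq (sameCycle_apply_right.2 SameCycle.rfl)).symm
    · rw [notMem_support.1 h]
  have hpp : ∀ a b, p a = p b → f.SameCycle a b := by
    intro a b hab
    by_cases ha : a ∈ f.support <;> by_cases hb : b ∈ f.support
    · rw [p_inl a ha, p_inl b hb, Sum.inl.injEq, Subtype.mk.injEq] at hab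
      exact (sameCycle_iff_cycleOf_eq_of_mem_support ha hb).2 hab
    · simp [p_inl a ha, p_inr b hb] at hab
    · simp [p_inr a ha, p_inl b hb] at hab
    · rw [p_inr a ha, p_inr b hb, Sum.inr.injEq, Subtype.mk.injEq] at hab
      rw [hab]
  have hrange : LinearMap.range (LinearMap.funLeft ℤ ℤ p) = f.invariantFunctions := by
    ext h
    constructor
    · rintro ⟨F, rfl⟩ a
      simp [LinearMap.funLeft_apply, hpf]
    · intro hh
      refine ⟨fun q => h (Function.surjInv hp q), funext fun a => ?_⟩
      exact (hpp _ _ (Function.surjInv_eq hp (p a))).apply_eq_of_comp_eq hh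
  have hfin := LinearMap.finrank_range_of_inj (LinearMap.funLeft_injective_of_surjective ℤ ℤ p hp)
  rw [hrange, Module.finrank_fintype_fun_eq_card, Fintype.card_sum, Fintype.card_coe,
    Fintype.card_subtype_compl, Fintype.card_coe] at hfin
  have hcard : Multiset.card f.cycleType = f.cycleFactorsFinset.card := by
    rw [cycleType_def, Multiset.card_map, Finset.card_val]
  have hle : f.support.card ≤ Fintype.card α := Finset.card_le_univ _
  -- The `d` fixed points enter both the cardinality and the rank, so they contribute the even
  -- number `2 * d`.
  rw [sign_of_cycleType, sum_cycleType, hcard, hfin]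
  obtain ⟨d, hd⟩ := Nat.exists_eq_add_of_le hle
  rw [hd, Nat.add_sub_cancel_left]
  have : f.support.card + d + (f.cycleFactorsFinset.card + d) =
      f.support.card + f.cycleFactorsFinset.card + 2 * d := by ring
  rw [this, pow_add _ _ (2 * d), pow_mul]
  simp

end Equiv.Perm

/-! ### The homology of the curve, of the sphere and of the Seifert surface -/

namespace KnotDiagram

variable (D : KnotDiagram)

/-- Without crossings this encoding has no edges and hence no regions, against the count `n + 2`. -/
theorem n_pos : 0 < D.n := by
  rcases Nat.eq_zero_or_pos D.n with h | h
  · exfalso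
    have hE : IsEmpty D.Edge := by
      change IsEmpty (Fin D.n × Bool)
      rw [h]; infer_instance
    have : IsEmpty D.Region := ⟨fun r => by
      induction r using Quot.ind with
      | mk p => exact hE.elim p.1⟩
    have h2 := D.planar
    rw [Nat.card_of_isEmpty] at h2
    omega
  · exact h

theorem eq_of_next_eq {β : Type*} {F : D.Edge → β} (hF : ∀ e, F (D.next e) = F e) (e e' : D.Edge) :
    F e = F e' :=
  (D.single e e').apply_eq_of_comp_eq hF

theorem sum_out {A : Type*} [AddCommMonoid A] (g : D.Edge → A) :
    ∑ c, (g (D.outL c) + g (D.outR c)) = ∑ e, g e := by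
  change _ = ∑ e : Fin D.n × Bool, g e
  rw [Fintype.sum_prod_type]
  refine Finset.sum_congr rfl fun c _ => ?_
  rw [Fintype.sum_bool, add_comm]
  rfl

theorem sum_in {A : Type*} [AddCommMonoid A] (g : D.Edge → A) :
    ∑ c, (g (D.inL c) + g (D.inR c)) = ∑ e, g e := by
  have h := D.sum_out (fun e => g (D.next.symm e))
  rw [Equiv.sum_comp D.next.symm g] at h
  rw [← h]
  refine Finset.sum_congr rfl fun c _ => ?_
  rw [add_comm]
  rfl

/-- The cellular boundary of a 1-chain of the curve. -/
def boundary : (D.Edge → ℤ) →ₗ[ℤ] (Fin D.n → ℤ) where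
  toFun x c := x (D.inL c) + x (D.inR c) - (x (D.outL c) + x (D.outR c))
  map_add' x y := by funext c; simp only [Pi.add_apply]; ring
  map_smul' a x := by
    funext c; simp only [Pi.smul_apply, smul_eq_mul, RingHom.id_apply]; ring

theorem ker_boundary : LinearMap.ker D.boundary = D.cycles := by
  ext x
  constructor
  · intro h c
    have : x (D.inL c) + x (D.inR c) - (x (D.outL c) + x (D.outR c)) = 0 := congrFun h c
    linarith
  · intro h
    funext c
    have := h c
    change x (D.inL c) + x (D.inR c) - (x (D.outL c) + x (D.outR c)) = 0
    linarith

/-- The sum of the coefficients of a 0-chain. -/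
def augmentation : (Fin D.n → ℤ) →ₗ[ℤ] ℤ := ∑ c, LinearMap.proj c

theorem augmentation_apply (z : Fin D.n → ℤ) : D.augmentation z = ∑ c, z c := by
  simp [augmentation]

theorem boundary_single (e : D.Edge) :
    D.boundary (Pi.single e 1) = Pi.single (D.next e).1 1 - Pi.single e.1 1 := by
  have hin : ∀ p : D.Edge, (Pi.single e 1 : D.Edge → ℤ) (D.next.symm p) =
      (Pi.single (D.next e) 1 : D.Edge → ℤ) p := by
    intro p
    simp only [Pi.single_apply, Equiv.symm_apply_eq]
  have hsum : ∀ (p : D.Edge) (c : Fin D.n), (Pi.single p 1 : D.Edge → ℤ) (c, true) +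
      (Pi.single p 1 : D.Edge → ℤ) (c, false) = (Pi.single p.1 1 : Fin D.n → ℤ) c := by
    rintro ⟨d, b⟩ c
    cases b <;> simp [Pi.single_apply, Prod.ext_iff]
  funext c
  change (Pi.single e 1 : D.Edge → ℤ) (D.next.symm (c, true)) +
    (Pi.single e 1 : D.Edge → ℤ) (D.next.symm (c, false)) -
    ((Pi.single e 1 : D.Edge → ℤ) (c, false) + (Pi.single e 1 : D.Edge → ℤ) (c, true)) = _
  rw [hin, hin, add_comm ((Pi.single e 1 : D.Edge → ℤ) (c, false)), hsum, hsum]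
  rfl

/-- Connectedness: the single curve visits every crossing, so all vertices agree modulo boundaries.
-/
theorem range_boundary : LinearMap.range D.boundary = LinearMap.ker D.augmentation := by
  apply le_antisymm
  · rintro _ ⟨x, rfl⟩
    rw [LinearMap.mem_ker, augmentation_apply]
    change ∑ c, (x (D.inL c) + x (D.inR c) - (x (D.outL c) + x (D.outR c))) = 0
    rw [Finset.sum_sub_distrib, sum_in, sum_out, sub_self]
  · intro z hz
    rw [LinearMap.mem_ker, augmentation_apply] at hz
    let q := (LinearMap.range D.boundary).mkQ
    have hq : ∀ e : D.Edge, q (Pi.single (D.next e).1 1) = q (Pi.single e.1 1) := by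
      intro e
      rw [← sub_eq_zero, ← map_sub, ← boundary_single]
      exact (Submodule.Quotient.mk_eq_zero _).2 ⟨_, rfl⟩
    have hq' := D.eq_of_next_eq (F := fun e => q (Pi.single e.1 1)) hq
    have hz' : z = ∑ c, z c • (Pi.single c 1 : Fin D.n → ℤ) := by
      funext d
      simp [Finset.sum_apply, Pi.single_apply]
    rw [← Submodule.Quotient.mk_eq_zero]
    change q z = 0
    let c₀ : Fin D.n := ⟨0, D.n_pos⟩
    rw [hz', map_sum, Finset.sum_congr rfl fun c _ => (by
      rw [map_smul, hq' (c, true) (c₀, true)] :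
        q (z c • (Pi.single c 1 : Fin D.n → ℤ)) = z c • q (Pi.single c₀ 1)), ← Finset.sum_smul, hz,
      zero_smul]

/-- Euler characteristic of a connected graph: `2n` edges, `n` vertices, first Betti number `n + 1`.
-/
theorem finrank_cycles : Module.finrank ℤ D.cycles = D.n + 1 := by
  have h1 := D.boundary.finrank_range_add_finrank_ker_of_isDomain
  have h2 := D.augmentation.finrank_range_add_finrank_ker_of_isDomain
  have h3 : LinearMap.range D.augmentation = ⊤ := by
    rw [LinearMap.range_eq_top]
    intro a
    exact ⟨Pi.single ⟨0, D.n_pos⟩ a, by simp [augmentation_apply]⟩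
  rw [ker_boundary, range_boundary] at h1
  rw [h3, finrank_top, Module.finrank_self] at h2
  have h4 : Module.finrank ℤ (D.Edge → ℤ) = D.n * 2 := by
    change Module.finrank ℤ (Fin D.n × Bool → ℤ) = D.n * 2
    simp
  have h5 : Module.finrank ℤ (Fin D.n → ℤ) = D.n := by simp
  rw [h4] at h1
  rw [h5] at h2
  omega

/-! ### Seifert circles and the parity of the rank of `SeifertH1` -/

/-- The permutation of the edges that follows the Seifert circles. -/
def seifertPerm : Equiv.Perm D.Edge :=
  D.next.trans (Equiv.prodCongrRight fun _ : Fin D.n => Equiv.swap true false)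

theorem seifertPerm_inL (c : Fin D.n) : D.seifertPerm (D.inL c) = D.outL c := by
  simp [seifertPerm, OrientedShadow.inL, OrientedShadow.outL]

theorem seifertPerm_inR (c : Fin D.n) : D.seifertPerm (D.inR c) = D.outR c := by
  simp [seifertPerm, OrientedShadow.inR, OrientedShadow.outR]

theorem edge_cases (e : D.Edge) : ∃ c, e = D.inL c ∨ e = D.inR c := by
  obtain ⟨⟨c, b⟩, rfl⟩ := D.next.symm.surjective e
  cases b
  · exact ⟨c, Or.inr rfl⟩
  · exact ⟨c, Or.inl rfl⟩

theorem mem_discBoundaries {x : D.cycles} :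
    x ∈ D.discBoundaries ↔
      ∀ c, x.1 (D.outL c) = x.1 (D.inL c) ∧ x.1 (D.outR c) = x.1 (D.inR c) := by
  have h : x ∈ D.discBoundaries ↔ ∀ c, x.1 (D.outL c) - x.1 (D.inL c) = 0 :=
    LinearMap.mem_ker.trans funext_iff
  rw [h]
  refine forall_congr' fun c => ?_
  have := x.2 c
  constructor
  · intro h; constructor <;> linarith
  · rintro ⟨h, -⟩; linarith

/-- Turns the rank of `discBoundaries` into the number of cycles of `seifertPerm`, so that
permutation signs control its parity. -/
theorem map_discBoundaries :
    D.discBoundaries.map D.cycles.subtype = D.seifertPerm.invariantFunctions := by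
  ext h
  constructor
  · rintro ⟨x, hx, rfl⟩ e
    have hx' := D.mem_discBoundaries.1 hx
    obtain ⟨c, rfl | rfl⟩ := D.edge_cases e
    · rw [seifertPerm_inL]; exact (hx' c).1
    · rw [seifertPerm_inR]; exact (hx' c).2
  · intro hh
    have h1 : ∀ c, h (D.outL c) = h (D.inL c) := fun c => by
      rw [← seifertPerm_inL]; exact hh _
    have h2 : ∀ c, h (D.outR c) = h (D.inR c) := fun c => by
      rw [← seifertPerm_inR]; exact hh _
    exact ⟨⟨h, fun c => by rw [h1, h2]⟩, D.mem_discBoundaries.2 fun c => ⟨h1 c, h2 c⟩, rfl⟩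

/-- The genus of the Seifert surface of a knot diagram is an integer. -/
theorem even_finrank_seifertH1 : Even (Module.finrank ℤ D.SeifertH1) := by
  have h1 := D.discBoundaries.finrank_quotient_add_finrank
  have h2 : Module.finrank ℤ D.discBoundaries =
      Module.finrank ℤ D.seifertPerm.invariantFunctions := by
    rw [← map_discBoundaries]
    exact (Submodule.equivMapOfInjective _ D.cycles.injective_subtype _).finrank_eq
  have h3 : Module.finrank ℤ D.next.invariantFunctions = 1 := by
    have hr : LinearMap.range (LinearMap.funLeft ℤ ℤ (fun _ : D.Edge => ())) =
        D.next.invariantFunctions := by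
      ext h
      constructor
      · rintro ⟨F, rfl⟩ a; rfl
      · intro hh
        exact ⟨fun _ => h (⟨0, D.n_pos⟩, true), funext fun e => D.eq_of_next_eq hh _ e⟩
    have hs : Function.Surjective (fun _ : D.Edge => ()) :=
      fun _ => ⟨((⟨0, D.n_pos⟩, true) : D.Edge), rfl⟩
    rw [← hr, LinearMap.finrank_range_of_inj (LinearMap.funLeft_injective_of_surjective ℤ ℤ _ hs)]
    simp
  -- `next` is one cycle of length `2n` and smoothing composes it with one transposition per
  -- crossing. So the number of Seifert circles is congruent to `n + 1` modulo 2, and the rank of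
  -- the homology, `n + 1` minus that number, is even.
  have h4 : Equiv.Perm.sign D.seifertPerm = (-1) ^ D.n * Equiv.Perm.sign D.next := by
    have : D.seifertPerm = (Equiv.prodCongrRight fun _ : Fin D.n => Equiv.swap true false) *
      D.next := rfl
    rw [this, Equiv.Perm.sign_mul, Equiv.Perm.sign_prodCongrRight]
    simp
  have h5 : Fintype.card D.Edge = D.n * 2 := by
    change Fintype.card (Fin D.n × Bool) = _
    simp
  rw [Equiv.Perm.sign_eq_finrank_invariantFunctions, Equiv.Perm.sign_eq_finrank_invariantFunctions,
    h3, h5, ← h2, ← pow_add] at h4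
  rw [D.finrank_cycles] at h1
  have h6 : Even (D.n * 2 + Module.finrank ℤ D.discBoundaries) ↔ Even (D.n + (D.n * 2 + 1)) := by
    rw [← neg_one_pow_eq_one_iff_even (R := ℤ) (by norm_num),
      ← neg_one_pow_eq_one_iff_even (R := ℤ) (by norm_num)]
    have := congrArg (Units.val) h4
    push_cast at this
    rw [this]
  change Even (Module.finrank ℤ (D.cycles ⧸ D.discBoundaries))
  have h7 : Even (D.n + 1) ↔ (Even (Module.finrank ℤ (D.cycles ⧸ D.discBoundaries)) ↔
    Even (Module.finrank ℤ D.discBoundaries)) := by rw [← h1, Nat.even_add]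
  simp only [Nat.even_add, Nat.even_mul, even_two, or_true, true_iff, Nat.not_even_one,
    iff_false] at h6 h7
  tauto

/-! ### Regions and the homology of the sphere -/

/-- The region on the left (`b = true`) or right (`b = false`) of an edge. -/
def region (e : D.Edge) (b : Bool) : D.Region := Quot.mk _ (e, b)

theorem region_west (c : Fin D.n) : D.region (D.inL c) true = D.region (D.outL c) true :=
  Quot.sound (.west c)

theorem region_north (c : Fin D.n) : D.region (D.outL c) false = D.region (D.outR c) true :=
  Quot.sound (.north c)

theorem region_east (c : Fin D.n) : D.region (D.outR c) false = D.region (D.inR c) false :=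
  Quot.sound (.east c)

theorem region_south (c : Fin D.n) : D.region (D.inR c) true = D.region (D.inL c) false :=
  Quot.sound (.south c)

/-- The boundary of a 2-chain of the sphere. -/
def regionBoundary : (D.Region → ℤ) →ₗ[ℤ] D.cycles where
  toFun r := ⟨fun e => r (D.region e true) - r (D.region e false), fun c => by
    simp only [region_west, region_north, region_east, region_south]
    ring⟩
  map_add' r s := by ext e; simp only [Submodule.coe_add, Pi.add_apply]; ring
  map_smul' a r := by
    ext e
    simp only [Submodule.coe_smul, Pi.smul_apply, smul_eq_mul, RingHom.id_apply]
    ring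

/-- A 2-chain without boundary takes equal values on both sides of each edge. Consecutive edges
share a region, so following the curve makes it constant. -/
theorem ker_regionBoundary :
    LinearMap.ker D.regionBoundary =
      LinearMap.range (LinearMap.funLeft ℤ ℤ (fun _ : D.Region => ())) := by
  ext r
  constructor
  · intro hr
    have h0 : ∀ e, r (D.region e true) = r (D.region e false) := fun e =>
      sub_eq_zero.1 (congrFun (congrArg Subtype.val (LinearMap.mem_ker.1 hr)) e)
    have h1 : ∀ e, r (D.region (D.next e) true) = r (D.region e true) := by
      intro e
      obtain ⟨c, rfl | rfl⟩ := D.edge_cases e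
      · have : D.next (D.inL c) = D.outR c := D.next.apply_symm_apply _
        rw [this, ← region_north, ← h0, ← region_west]
      · have : D.next (D.inR c) = D.outL c := D.next.apply_symm_apply _
        rw [this, ← region_west, h0, ← region_south]
    have h2 := D.eq_of_next_eq (F := fun e => r (D.region e true)) h1
    let e₀ : D.Edge := (⟨0, D.n_pos⟩, true)
    refine ⟨fun _ => r (D.region e₀ true), funext fun q => ?_⟩
    induction q using Quot.ind with
    | mk p =>
      obtain ⟨e, b⟩ := p
      cases b
      · exact (h2 e₀ e).trans (h0 e)
      · exact h2 e₀ e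
  · rintro ⟨F, rfl⟩
    refine LinearMap.mem_ker.2 (Subtype.ext (funext fun e => ?_))
    exact sub_self (F ())

/-- On the sphere, a multiple of every cycle is a boundary. -/
theorem exists_smul_eq_regionBoundary (y : D.cycles) :
    ∃ (N : ℤ) (r : D.Region → ℤ), N ≠ 0 ∧ N • y = D.regionBoundary r := by
  have hfin : Finite D.Region := Nat.finite_of_card_ne_zero (by rw [D.planar]; omega)
  have : Fintype D.Region := Fintype.ofFinite _
  have h1 := D.regionBoundary.finrank_range_add_finrank_ker_of_isDomain
  have hs : Function.Surjective (fun _ : D.Region => ()) := fun _ =>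
    ⟨Quot.mk _ (((⟨0, D.n_pos⟩, true) : D.Edge), true), rfl⟩
  rw [ker_regionBoundary,
    LinearMap.finrank_range_of_inj (LinearMap.funLeft_injective_of_surjective ℤ ℤ _ hs),
    Module.finrank_fintype_fun_eq_card, Module.finrank_fintype_fun_eq_card,
    ← Nat.card_eq_fintype_card (α := D.Region), D.planar, Fintype.card_unit] at h1
  have h2 := (LinearMap.range D.regionBoundary).finrank_quotient_add_finrank
  rw [finrank_cycles] at h2
  -- By planarity the boundaries have rank `(n + 2) - 1`, the rank of all cycles, so the quotient is
  -- torsion.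
  have h3 : Module.finrank ℤ (D.cycles ⧸ LinearMap.range D.regionBoundary) = 0 := by omega
  rw [Module.finrank_eq_zero_iff] at h3
  obtain ⟨N, hN, h⟩ := h3 ((LinearMap.range D.regionBoundary).mkQ y)
  rw [← map_smul, Submodule.mkQ_apply, Submodule.Quotient.mk_eq_zero] at h
  obtain ⟨r, hr⟩ := h
  exact ⟨N, r, hN, hr.symm⟩

/-! ### The linking form on homology and crossing changes -/

/-- The linking number as a bilinear form. -/
def linkingForm : D.cycles →ₗ[ℤ] D.cycles →ₗ[ℤ] ℤ :=
  LinearMap.mk₂ ℤ D.linking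
    (fun x x' y => by
      simp only [linking, ← Finset.sum_add_distrib]
      refine Finset.sum_congr rfl fun c _ => ?_
      split_ifs <;> simp only [Submodule.coe_add, Pi.add_apply] <;> ring)
    (fun a x y => by
      simp only [linking, smul_eq_mul, Finset.mul_sum]
      refine Finset.sum_congr rfl fun c _ => ?_
      split_ifs <;> simp only [Submodule.coe_smul, Pi.smul_apply, smul_eq_mul] <;> ring)
    (fun x y y' => by
      simp only [linking, ← Finset.sum_add_distrib, map_add, Pi.add_apply, mul_add])
    (fun a x y => by
      simp only [linking, smul_eq_mul, Finset.mul_sum, map_smul, Pi.smul_apply]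
      exact Finset.sum_congr rfl fun c _ => by ring)

theorem linkingForm_apply (x y : D.cycles) : D.linkingForm x y = D.linking x y := rfl

theorem linking_discBoundaries_right {y : D.cycles} (hy : y ∈ D.discBoundaries) (x : D.cycles) :
    D.linking x y = 0 := by
  have : D.bandFlow y = 0 := hy
  simp [linking, this]

/-- After scaling, `y` bounds a 2-chain `r` on the sphere. As `x` is constant along Seifert circles,
the sign of a crossing does not matter. The sum becomes that of `x · r(left side)` over incoming
minus outgoing edges, which is zero. -/
theorem linking_discBoundaries_left {x : D.cycles} (hx : x ∈ D.discBoundaries) (y : D.cycles) :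
    D.linking x y = 0 := by
  obtain ⟨N, r, hN, hr⟩ := D.exists_smul_eq_regionBoundary y
  have hx' := D.mem_discBoundaries.1 hx
  suffices h : D.linking x (N • y) = 0 by
    rw [← linkingForm_apply, map_smul, smul_eq_mul] at h
    exact (mul_eq_zero.1 h).resolve_left hN
  rw [hr]
  have hsum := (D.sum_in fun e => x.1 e * r (D.region e true)).trans
    (D.sum_out fun e => x.1 e * r (D.region e true)).symm
  rw [← sub_eq_zero, ← Finset.sum_sub_distrib] at hsum
  rw [← hsum, linking]
  refine Finset.sum_congr rfl fun c _ => ?_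
  have hb : D.bandFlow (D.regionBoundary r) c =
      (r (D.region (D.outL c) true) - r (D.region (D.outL c) false)) -
        (r (D.region (D.inL c) true) - r (D.region (D.inL c) false)) := rfl
  rw [hb, region_west, region_north, ← region_south, (hx' c).1, (hx' c).2, ite_self]
  ring

/-- The Seifert matrices of a diagram for different bases and representatives are congruent. -/
theorem IsDiagramSeifertMatrix.congruent {D : KnotDiagram} {m k : ℕ} {V : Matrix (Fin m) (Fin m) ℤ}
    {W : Matrix (Fin k) (Fin k) ℤ} (hV : D.IsDiagramSeifertMatrix V)
    (hW : D.IsDiagramSeifertMatrix W) : SEquivalent V W := by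
  obtain ⟨b, x, hx, hV⟩ := hV
  obtain ⟨b', x', hx', hW⟩ := hW
  obtain rfl : m = k := by
    have h1 := Module.finrank_eq_card_basis b
    have h2 := Module.finrank_eq_card_basis b'
    simpa using h1.symm.trans h2
  let P := b.toMatrix b'
  have hP : IsUnit P.det := by
    rw [← Matrix.isUnit_iff_isUnit_det]
    have := b.invertibleToMatrix b'
    exact isUnit_of_invertible _
  have hmem : ∀ j, x' j - ∑ i, P i j • x i ∈ D.discBoundaries := by
    intro j
    rw [← Submodule.Quotient.mk_eq_zero, ← Submodule.mkQ_apply, map_sub, map_sum, hx', sub_eq_zero,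
      ← b.sum_toMatrix_smul_self b' j]
    exact Finset.sum_congr rfl fun i _ => by rw [map_smul, hx]
  have hW' : W = P.transpose * V * P := by
    ext i j
    have h1 : D.linkingForm (x' i) (x' j) =
        D.linkingForm (∑ k, P k i • x k) (∑ l, P l j • x l) := by
      have h2 := D.linking_discBoundaries_left (hmem i) (x' j)
      have h3 := D.linking_discBoundaries_right (hmem j) (∑ k, P k i • x k)
      rw [← linkingForm_apply, map_sub, LinearMap.sub_apply] at h2
      rw [← linkingForm_apply, map_sub] at h3
      linarith
    rw [hW, ← linkingForm_apply, h1]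
    simp only [map_sum, map_smul, LinearMap.sum_apply, LinearMap.smul_apply, smul_eq_mul,
      linkingForm_apply, ← hV, Matrix.mul_apply, Matrix.transpose_apply, Finset.sum_mul,
      Finset.mul_sum]
    refine Finset.sum_congr rfl fun l _ => Finset.sum_congr rfl fun k _ => by ring
  rw [hW']
  exact .congruent V P hP

theorem IsDiagramSeifertMatrix.even {D : KnotDiagram} {m : ℕ} {V : Matrix (Fin m) (Fin m) ℤ}
    (hV : D.IsDiagramSeifertMatrix V) : Even m := by
  obtain ⟨b, -⟩ := hV
  have h := D.even_finrank_seifertH1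
  rwa [Module.finrank_eq_card_basis b, Fintype.card_fin] at h

theorem resolve_sign (c : Fin D.n) : D.resolve c (D.sign c) = D := by
  simp [resolve]

/-- A crossing change alters the Seifert matrix by a symmetric matrix of rank at most one. -/
theorem IsDiagramSeifertMatrix.crossingChange {D : KnotDiagram} {m : ℕ}
    {V : Matrix (Fin m) (Fin m) ℤ} (hV : D.IsDiagramSeifertMatrix V) (c : Fin D.n) :
    ∃ f : Fin m → ℤ, (D.resolve c (-D.sign c)).IsDiagramSeifertMatrix
      (V + (D.sign c : ℤ) • Matrix.vecMulVec f f) := by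
  obtain ⟨b, x, hx, hV⟩ := hV
  -- Cycles and homology do not involve the signs, so the same basis and representatives serve for
  -- the changed diagram.
  refine ⟨fun i => D.bandFlow (x i) c, b, x, hx, fun i j => ?_⟩
  have hlink : (D.resolve c (-D.sign c)).linking (x i) (x j) = ∑ d,
      (if (Function.update D.sign c (-D.sign c)) d = 1 then (x i).1 (D.outR d)
        else (x i).1 (D.inR d)) * D.bandFlow (x j) d := rfl
  rw [hlink]
  change V i j + (D.sign c : ℤ) * (D.bandFlow (x i) c * D.bandFlow (x j) c) = _
  rw [hV, linking, ← eq_sub_iff_add_eq', ← Finset.sum_sub_distrib, Finset.sum_eq_single c]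
  · have h := (x i).2 c
    have hb : D.bandFlow (x i) c = (x i).1 (D.outL c) - (x i).1 (D.inL c) := rfl
    rw [Function.update_self, hb]
    rcases Int.units_eq_one_or (D.sign c) with hs | hs
    · have h1 : ¬ (-1 : ℤˣ) = 1 := by decide
      simp only [hs, h1, if_true, if_false, Units.val_one]
      linear_combination (D.bandFlow (x j) c) * h
    · have h1 : ¬ (-1 : ℤˣ) = 1 := by decide
      simp only [hs, h1, if_true, if_false, neg_neg, Units.val_neg, Units.val_one]
      linear_combination (D.bandFlow (x j) c) * (-h)
  · intro d _ hd
    rw [Function.update_of_ne hd, sub_self]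
  · simp

end KnotDiagram

/-! ### The Alexander polynomial and the Hermitian form on the unit circle -/

section Circle

theorem star_eq_inv_of_norm_eq_one {t : ℂ} (ht : ‖t‖ = 1) : star t = t⁻¹ := by
  rw [Complex.inv_def, Complex.normSq_eq_norm_sq, ht]
  simp

theorem norm_circlePoint (φ : ℝ) : ‖circlePoint φ‖ = 1 := Complex.norm_exp_ofReal_mul_I φ

theorem circlePoint_ne_zero (φ : ℝ) : circlePoint φ ≠ 0 := Complex.exp_ne_zero _

theorem hasDerivAt_circlePoint (φ : ℝ) :
    HasDerivAt circlePoint (circlePoint φ * Complex.I) φ := by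
  have h : HasDerivAt (fun φ : ℝ => (φ : ℂ) * Complex.I) Complex.I φ := by
    simpa using (Complex.ofRealCLM.hasDerivAt (x := φ)).mul_const Complex.I
  exact h.cexp

variable {m : ℕ} (V : Matrix (Fin m) (Fin m) ℤ)

theorem alexander_star (t : ℂ) : alexander V (star t) = star (alexander V t) := by
  have h : Polynomial.aeval (star t) (alexanderPoly V) =
      star (Polynomial.aeval t (alexanderPoly V)) := by
    have := Polynomial.aeval_algHom_apply (starRingEnd ℂ).toIntAlgHom t (alexanderPoly V)
    exact this
  rw [alexander, alexander, h, star_mul', star_zpow₀]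

/-- With `M` the complex matrix of `V`, `t⁻¹ M - Mᵀ = -t⁻¹ (t M - Mᵀ)ᵀ`; even size removes the sign.
-/
theorem aeval_inv_alexanderPoly (hm : Even m) {t : ℂ} (ht : t ≠ 0) :
    Polynomial.aeval t⁻¹ (alexanderPoly V) = (t ^ m)⁻¹ * Polynomial.aeval t (alexanderPoly V) := by
  set M := V.map (Int.cast : ℤ → ℂ) with hM
  have h : t⁻¹ • M - M.transpose = (-t⁻¹) • (t • M - M.transpose).transpose := by
    rw [Matrix.transpose_sub, Matrix.transpose_smul, Matrix.transpose_transpose, smul_sub,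
      smul_smul, neg_mul, inv_mul_cancel₀ ht]
    simp
    abel
  rw [aeval_alexanderPoly, aeval_alexanderPoly, ← hM, h, Matrix.det_smul, Matrix.det_transpose,
    Fintype.card_fin, hm.neg_pow, inv_pow]

/-- The symmetrized Alexander polynomial is real on the unit circle. -/
theorem ofReal_re_alexander (hm : Even m) {t : ℂ} (ht : ‖t‖ = 1) :
    ((alexander V t).re : ℂ) = alexander V t := by
  have h0 : t ≠ 0 := fun h => by simp [h] at ht
  rw [← Complex.conj_eq_iff_re, starRingEnd_apply, ← alexander_star,
    star_eq_inv_of_norm_eq_one ht, alexander, alexander, aeval_inv_alexanderPoly V hm h0,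
    ← mul_assoc]
  congr 1
  obtain ⟨g, rfl⟩ := hm
  have : (g + g) / 2 = g := by omega
  rw [this, inv_zpow, ← zpow_natCast, ← zpow_neg, ← zpow_neg, ← zpow_add₀ h0]
  congr 1
  push_cast
  ring

/-- On the circle `1 - t̄ = -(1 - t) t⁻¹`, so the form is `(1 - t) t⁻¹ (t V - Vᵀ)`. The scalar has
square `-|1 - t|² t⁻¹`, whose `g`-th power supplies the normalization `t^(-g)`. -/
theorem det_hermitianForm (hm : Even m) {t : ℂ} (ht : ‖t‖ = 1) :
    (hermitianForm V t).det = ((-Complex.normSq (1 - t)) ^ (m / 2) : ℝ) * alexander V t := by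
  have h0 : t ≠ 0 := fun h => by simp [h] at ht
  have h : hermitianForm V t = ((1 - t) * t⁻¹) •
      (t • V.map (Int.cast : ℤ → ℂ) - (V.map (Int.cast : ℤ → ℂ)).transpose) := by
    have h1 : (1 - t) * t⁻¹ * t = 1 - t := by field_simp
    have h2 : 1 - t⁻¹ = -((1 - t) * t⁻¹) := by field_simp; ring
    rw [hermitianForm, star_eq_inv_of_norm_eq_one ht, smul_sub, smul_smul, h1, h2, neg_smul,
      ← sub_eq_add_neg]
  have h3 : ((-Complex.normSq (1 - t) : ℝ) : ℂ) * t⁻¹ = ((1 - t) * t⁻¹) ^ 2 := by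
    rw [Complex.ofReal_neg, Complex.normSq_eq_conj_mul_self, starRingEnd_apply, star_sub, star_one,
      star_eq_inv_of_norm_eq_one ht]
    field_simp
    ring
  obtain ⟨g, rfl⟩ := hm
  have hg : (g + g) / 2 = g := by omega
  rw [h, Matrix.det_smul, Fintype.card_fin, ← aeval_alexanderPoly, alexander, hg, ← mul_assoc]
  congr 1
  rw [← two_mul, pow_mul, ← h3, mul_pow, Complex.ofReal_pow, zpow_neg, zpow_natCast, inv_pow]

theorem det_hermitianForm_ne_zero (hm : Even m) {t : ℂ} (ht : ‖t‖ = 1) (ht1 : t ≠ 1)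
    (h : alexander V t ≠ 0) : (hermitianForm V t).det ≠ 0 := by
  rw [det_hermitianForm V hm ht]
  refine mul_ne_zero (Complex.ofReal_ne_zero.2 (pow_ne_zero _ (neg_ne_zero.2 ?_))) h
  rw [Ne, Complex.normSq_eq_zero, sub_eq_zero]
  exact ht1.symm

theorem reForm_hermitianForm_add (f : Fin m → ℤ) (s : ℤ) {t : ℂ} (ht : ‖t‖ = 1) (x : Fin m → ℂ) :
    (hermitianForm (V + s • Matrix.vecMulVec f f) t).reForm x = (hermitianForm V t).reForm x +
      s * Complex.normSq (1 - t) * ‖∑ i, (f i : ℂ) * x i‖ ^ 2 := by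
  let w : Fin m → ℂ := fun i => f i
  have h0 : t ≠ 0 := fun h => by simp [h] at ht
  have h1 : hermitianForm (V + s • Matrix.vecMulVec f f) t = hermitianForm V t +
      ((s * Complex.normSq (1 - t) : ℝ) : ℂ) • Matrix.vecMulVec w w := by
    have hn : ((s * Complex.normSq (1 - t) : ℝ) : ℂ) = s * ((1 - t) + (1 - star t)) := by
      rw [Complex.ofReal_mul, Complex.normSq_eq_conj_mul_self, starRingEnd_apply, star_sub,
        star_one, star_eq_inv_of_norm_eq_one ht, Complex.ofReal_intCast]
      field_simp
      ring
    have hent : ∀ i j, (V + s • Matrix.vecMulVec f f) i j = V i j + s * (f i * f j) :=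
      fun i j => rfl
    have hH : ∀ (W : Matrix (Fin m) (Fin m) ℤ) (i j : Fin m),
        hermitianForm W t i j = (1 - t) * (W i j : ℂ) + (1 - star t) * (W j i : ℂ) :=
      fun _ _ _ => rfl
    rw [hn]
    ext i j
    rw [hH, hent, hent, Matrix.add_apply, hH, Matrix.smul_apply, Matrix.vecMulVec_apply,
      smul_eq_mul]
    push_cast
    ring
  have h2 : star x ⬝ᵥ (Matrix.vecMulVec w w).mulVec x =
      ((‖∑ i, (f i : ℂ) * x i‖ ^ 2 : ℝ) : ℂ) := by
    have ha : star x ⬝ᵥ w = star (∑ i, (f i : ℂ) * x i) := by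
      simp [dotProduct, w, mul_comm]
    have hb : w ⬝ᵥ x = ∑ i, (f i : ℂ) * x i := rfl
    have hc : (Matrix.vecMulVec w w).mulVec x = (w ⬝ᵥ x) • w := by
      funext i
      simp only [Matrix.mulVec, dotProduct, Matrix.vecMulVec_apply, Pi.smul_apply, smul_eq_mul,
        Finset.sum_mul]
      exact Finset.sum_congr rfl fun j _ => by ring
    rw [hc, dotProduct_smul, ha, hb, smul_eq_mul, mul_comm, Complex.star_def, Complex.conj_mul']
    push_cast
    rfl
  rw [Matrix.reForm, Matrix.reForm, h1, Matrix.add_mulVec, dotProduct_add, Matrix.smul_mulVec,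
    dotProduct_smul, h2, smul_eq_mul, Complex.add_re, ← Complex.ofReal_mul, Complex.ofReal_re]

/-- The change of the signature under a rank one change of the Seifert matrix. -/
theorem signatureAt_rank_one (hm : Even m) (f : Fin m → ℤ) (ε : ℤˣ) {t : ℂ} (ht : ‖t‖ = 1)
    (ht1 : t ≠ 1) (hV : alexander V t ≠ 0)
    (hU : alexander (V + (ε : ℤ) • Matrix.vecMulVec f f) t ≠ 0) :
    signatureAt V t = signatureAt (V + (ε : ℤ) • Matrix.vecMulVec f f) t -
      ε * (1 - (SignType.sign (alexander V t).re : ℤ) *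
        (SignType.sign (alexander (V + (ε : ℤ) • Matrix.vecMulVec f f) t).re : ℤ)) := by
  set U := V + (ε : ℤ) • Matrix.vecMulVec f f with hUdef
  have hform := fun x => reForm_hermitianForm_add V f ε ht x
  rw [← hUdef] at hform
  have hdV := det_hermitianForm_ne_zero V hm ht ht1 hV
  have hdU := det_hermitianForm_ne_zero U hm ht ht1 hU
  have hn : 0 < Complex.normSq (1 - t) := by
    rw [Complex.normSq_pos, sub_ne_zero]
    exact ht1.symm
  have hsign : (SignType.sign (hermitianForm V t).det.re : ℤ) *
      (SignType.sign (hermitianForm U t).det.re : ℤ) =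
      (SignType.sign (alexander V t).re : ℤ) * (SignType.sign (alexander U t).re : ℤ) := by
    rw [det_hermitianForm V hm ht, det_hermitianForm U hm ht, Complex.re_ofReal_mul,
      Complex.re_ofReal_mul, ← SignType.coe_mul, ← SignType.coe_mul, ← sign_mul, ← sign_mul]
    -- The factor common to both determinants appears squared in the product and drops out of the
    -- sign.
    have hq : 0 < ((-Complex.normSq (1 - t)) ^ (m / 2)) ^ 2 := by
      have : (-Complex.normSq (1 - t)) ^ (m / 2) ≠ 0 := pow_ne_zero _ (neg_ne_zero.2 hn.ne')
      positivity
    rw [mul_mul_mul_comm, ← sq, sign_mul, sign_pos hq, one_mul]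
  let w : (Fin m → ℂ) →ₗ[ℂ] ℂ := ∑ i, (f i : ℂ) • LinearMap.proj i
  have hw : ∀ x, w x = ∑ i, (f i : ℂ) * x i := fun x => by simp [w]
  rw [signatureAt_eq_signature, signatureAt_eq_signature]
  rcases Int.units_eq_one_or ε with rfl | rfl
  · have := (hermitianForm_isHermitian V t).signature_add_rank_one (hermitianForm_isHermitian U t)
      hdV hdU w _ hn.le fun x => by rw [hform, hw]; push_cast; ring
    rw [this, hsign, Units.val_one]
    ring
  -- For `ε = -1` the form of `V` is the larger one, so the roles are exchanged.
  · have := (hermitianForm_isHermitian U t).signature_add_rank_one (hermitianForm_isHermitian V t)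
      hdU hdV w _ hn.le fun x => by rw [hform, hw]; push_cast; ring
    rw [this, mul_comm (SignType.sign (hermitianForm U t).det.re : ℤ), hsign, Units.val_neg,
      Units.val_one]
    ring

theorem hasDerivAt_alexander_circlePoint {θ : ℝ} (hroot : alexander V (circlePoint θ) = 0) :
    HasDerivAt (fun φ => alexander V (circlePoint φ))
      (circlePoint θ ^ (-((m / 2 : ℕ) : ℤ)) *
        Polynomial.aeval (circlePoint θ) (Polynomial.derivative (alexanderPoly V)) *
          (circlePoint θ * Complex.I)) θ := by
  have h0 := circlePoint_ne_zero θ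
  have hp : Polynomial.aeval (circlePoint θ) (alexanderPoly V) = 0 :=
    (mul_eq_zero.1 hroot).resolve_left (zpow_ne_zero _ h0)
  have h := (hasDerivAt_zpow (-((m / 2 : ℕ) : ℤ)) (circlePoint θ) (Or.inl h0)).mul
    ((alexanderPoly V).hasDerivAt_aeval (circlePoint θ))
  rw [hp, mul_zero, zero_add] at h
  exact h.comp θ (hasDerivAt_circlePoint θ)

/-- At a simple root the symmetrized Alexander polynomial, as a real function of the argument, has
nonzero derivative. -/
theorem exists_hasDerivAt_re_alexander (hm : Even m) (hsimple : HasSimpleCircleRoots V) {θ : ℝ}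
    (hroot : alexander V (circlePoint θ) = 0) :
    ∃ d : ℝ, d ≠ 0 ∧ HasDerivAt (fun φ => (alexander V (circlePoint φ)).re) d θ := by
  have h0 := circlePoint_ne_zero θ
  have hp : Polynomial.aeval (circlePoint θ) (alexanderPoly V) = 0 :=
    (mul_eq_zero.1 hroot).resolve_left (zpow_ne_zero _ h0)
  have hd := hasDerivAt_alexander_circlePoint V hroot
  have hne := mul_ne_zero (mul_ne_zero (zpow_ne_zero (-((m / 2 : ℕ) : ℤ)) h0)
    (hsimple _ (norm_circlePoint θ) hp)) (mul_ne_zero h0 Complex.I_ne_zero)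
  set d := circlePoint θ ^ (-((m / 2 : ℕ) : ℤ)) *
    Polynomial.aeval (circlePoint θ) (Polynomial.derivative (alexanderPoly V)) *
      (circlePoint θ * Complex.I)
  have hre : HasDerivAt (fun φ => (alexander V (circlePoint φ)).re) d.re θ :=
    Complex.reCLM.hasFDerivAt.comp_hasDerivAt θ hd
  -- The function is real-valued, so uniqueness of derivatives makes `d` real, and `d ≠ 0` passes to
  -- its real part.
  have heq : (d.re : ℂ) = d := by
    refine HasDerivAt.unique ?_ hd
    have := hre.ofReal_comp
    simpa only [ofReal_re_alexander V hm (norm_circlePoint _)] using this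
  exact ⟨d.re, fun h => hne (by rw [← heq, h, Complex.ofReal_zero]), hre⟩

/-- A root of the Alexander polynomial at `1` is multiple. -/
theorem circlePoint_ne_one_of_root (hm : Even m) (hsimple : HasSimpleCircleRoots V) {θ : ℝ}
    (hroot : alexander V (circlePoint θ) = 0) : circlePoint θ ≠ 1 := by
  intro h1
  obtain ⟨d, hd0, hd⟩ := exists_hasDerivAt_re_alexander V hm hsimple hroot
  -- If `e^{iθ} = 1`, reflection in `θ` is complex conjugation. The real function is then even about
  -- `θ`, which forces its derivative to vanish.
  have hrefl : ∀ φ, circlePoint (2 * θ - φ) = star (circlePoint φ) := by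
    intro φ
    rw [star_eq_inv_of_norm_eq_one (norm_circlePoint φ)]
    have : circlePoint (2 * θ - φ) = circlePoint θ ^ 2 / circlePoint φ := by
      rw [circlePoint, circlePoint, circlePoint, ← Complex.exp_nat_mul, ← Complex.exp_sub]
      congr 1
      push_cast
      ring
    rw [this, h1, one_pow, one_div]
  have hd' : HasDerivAt (fun φ => (alexander V (circlePoint (2 * θ - φ))).re) (-d) θ := by
    have hθ : 2 * θ - θ = θ := by ring
    have h2 : HasDerivAt (fun φ : ℝ => 2 * θ - φ) (-1) θ := by
      simpa using (hasDerivAt_id θ).const_sub (2 * θ)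
    have h3 := HasDerivAt.comp θ (by rw [hθ]; exact hd :
      HasDerivAt (fun φ => (alexander V (circlePoint φ)).re) d (2 * θ - θ)) h2
    rwa [mul_neg_one] at h3
  have hfun : (fun φ => (alexander V (circlePoint (2 * θ - φ))).re) =
      fun φ => (alexander V (circlePoint φ)).re := by
    funext φ
    rw [hrefl, alexander_star, Complex.star_def, Complex.conj_re]
  rw [hfun] at hd'
  exact hd0 (by linarith [hd.unique hd'])

/-! ### Signs near a simple zero and the jump -/

theorem sgnAt_of_ne_zero {f : ℝ → ℝ} {a : ℝ} (h : f a ≠ 0) : sgnAt f a = SignType.sign (f a) := by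
  classical
  have hex : ∃ k : ℕ, iteratedDeriv k f a ≠ 0 := ⟨0, by simpa using h⟩
  have hfind : Nat.find hex = 0 := by simpa [Nat.find_eq_zero] using h
  rw [sgnAt, dif_pos hex, hfind, iteratedDeriv_zero]

theorem sgnAt_of_hasDerivAt {f : ℝ → ℝ} {a d : ℝ} (h : f a = 0) (hd : HasDerivAt f d a)
    (hd0 : d ≠ 0) : sgnAt f a = SignType.sign d := by
  classical
  have h1 : iteratedDeriv 1 f a = d := by rw [iteratedDeriv_one, hd.deriv]
  have hex : ∃ k : ℕ, iteratedDeriv k f a ≠ 0 := ⟨1, by rwa [h1]⟩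
  have hfind : Nat.find hex = 1 := by
    rw [Nat.find_eq_iff]
    refine ⟨by rwa [h1], fun n hn => ?_⟩
    obtain rfl : n = 0 := by omega
    simpa using h
  rw [sgnAt, dif_pos hex, hfind, h1]

theorem eventually_sign_eq {f : ℝ → ℝ} {a d : ℝ} (h : f a = 0) (hd : HasDerivAt f d a)
    (hd0 : d ≠ 0) :
    ∀ᶠ x in 𝓝 a, SignType.sign (f x) = SignType.sign d * SignType.sign (x - a) := by
  rcases hd0.lt_or_gt with hneg | hpos
  · have h1 : deriv (-f) a > 0 := by rw [hd.neg.deriv]; linarith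
    filter_upwards [eventually_nhdsWithin_sign_eq_of_deriv_pos h1 (by simp [h])] with x hx
    rw [sign_neg hneg, ← hx, Pi.neg_apply, Left.sign_neg]
    simp
  · have h1 : deriv f a > 0 := by rwa [hd.deriv]
    filter_upwards [eventually_nhdsWithin_sign_eq_of_deriv_pos h1 h] with x hx
    rw [sign_pos hpos, hx, one_mul]

theorem continuous_circlePoint : Continuous circlePoint :=
  continuous_iff_continuousAt.2 fun φ => (hasDerivAt_circlePoint φ).continuousAt

theorem continuous_alexander_circlePoint : Continuous fun φ => alexander V (circlePoint φ) := by
  unfold alexander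
  refine (continuous_circlePoint.zpow₀ _ fun φ => Or.inl (circlePoint_ne_zero φ)).mul ?_
  exact (alexanderPoly V).continuous_aeval.comp continuous_circlePoint

theorem continuous_hermitianForm : Continuous (hermitianForm V) := by
  unfold hermitianForm
  fun_prop

/-- The jump of the signature function at a simple root that is not a root after a rank one
change of the Seifert matrix. -/
theorem hasJump_of_rank_one (hm : Even m) (f : Fin m → ℤ) (ε : ℤˣ) {θ d : ℝ}
    (h1 : circlePoint θ ≠ 1) (hroot : alexander V (circlePoint θ) = 0) (hd0 : d ≠ 0)
    (hd : HasDerivAt (fun φ => (alexander V (circlePoint φ)).re) d θ)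
    (hgood : alexander (V + (ε : ℤ) • Matrix.vecMulVec f f) (circlePoint θ) ≠ 0) :
    HasJump (signatureAt V) θ (2 * ε * (alexanderSgn V θ *
        alexanderSgn (V + (ε : ℤ) • Matrix.vecMulVec f f) θ)) ∧
      (alexanderSgn V θ * alexanderSgn (V + (ε : ℤ) • Matrix.vecMulVec f f) θ = 1 ∨
      alexanderSgn V θ * alexanderSgn (V + (ε : ℤ) • Matrix.vecMulVec f f) θ = -1) := by
  set U := V + (ε : ℤ) • Matrix.vecMulVec f f with hU
  have hgood' : (alexander U (circlePoint θ)).re ≠ 0 := fun h => hgood (by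
    rw [← ofReal_re_alexander U hm (norm_circlePoint θ), h, Complex.ofReal_zero])
  have hroot' : (alexander V (circlePoint θ)).re = 0 := by rw [hroot, Complex.zero_re]
  have hsV : alexanderSgn V θ = SignType.sign d := sgnAt_of_hasDerivAt hroot' hd hd0
  have hsU : alexanderSgn U θ = SignType.sign (alexander U (circlePoint θ)).re :=
    sgnAt_of_ne_zero hgood'
  have hcU : Continuous fun φ => (alexander U (circlePoint φ)).re :=
    Complex.continuous_re.comp (continuous_alexander_circlePoint U)
  -- In a punctured neighbourhood every term of the rank one formula is constant except `sgn Δ_V`,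
  -- which equals `sgn d · sgn (φ - θ)`.
  have key : ∀ᶠ φ in 𝓝 θ, φ ≠ θ → signatureAt V (circlePoint φ) =
      signatureAt U (circlePoint θ) - ε * (1 - (SignType.sign d : ℤ) *
        (SignType.sign (φ - θ) : ℤ) * (SignType.sign (alexander U (circlePoint θ)).re : ℤ)) := by
    have e1 : ∀ᶠ φ in 𝓝 θ, circlePoint φ ≠ 1 :=
      continuous_circlePoint.continuousAt.eventually_ne h1
    have e2 := eventually_sign_eq (f := fun φ => (alexander V (circlePoint φ)).re) hroot' hd hd0
    have e3 : ∀ᶠ φ in 𝓝 θ, SignType.sign (alexander U (circlePoint φ)).re =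
        SignType.sign (alexander U (circlePoint θ)).re := by
      rcases hgood'.lt_or_gt with hn | hp
      · filter_upwards [hcU.continuousAt.eventually_lt_const hn] with φ hφ
        rw [sign_neg hφ, sign_neg hn]
      · filter_upwards [hcU.continuousAt.eventually_const_lt hp] with φ hφ
        rw [sign_pos hφ, sign_pos hp]
    have e4 : ∀ᶠ φ in 𝓝 θ, signatureAt U (circlePoint φ) = signatureAt U (circlePoint θ) :=
      Matrix.eventually_signature_eq (fun φ => hermitianForm U (circlePoint φ))
        (fun φ => hermitianForm_isHermitian U (circlePoint φ)) θ
        ((continuous_hermitianForm U).comp continuous_circlePoint).continuousAt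
        (det_hermitianForm_ne_zero U hm (norm_circlePoint θ) h1 hgood)
    filter_upwards [e1, e2, e3, e4] with φ k1 k2 k3 k4 hφ
    have hVφ : alexander V (circlePoint φ) ≠ 0 := by
      intro h
      rw [h, Complex.zero_re, sign_zero, eq_comm, mul_eq_zero, sign_eq_zero_iff, sign_eq_zero_iff,
        sub_eq_zero] at k2
      exact k2.elim hd0 hφ
    have hUφ : alexander U (circlePoint φ) ≠ 0 := by
      intro h
      rw [h, Complex.zero_re, sign_zero, eq_comm, sign_eq_zero_iff] at k3
      exact hgood' k3
    rw [signatureAt_rank_one V hm f ε (norm_circlePoint φ) k1 hVφ hUφ, ← hU, k4, k2, k3,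
      SignType.coe_mul]
  have unit : ∀ r : ℝ, r ≠ 0 → (SignType.sign r : ℤ) = 1 ∨ (SignType.sign r : ℤ) = -1 := by
    intro r hr
    rcases hr.lt_or_gt with h | h
    · simp [h]
    · simp [h]
  constructor
  · refine ⟨signatureAt U (circlePoint θ) - ε * (1 - alexanderSgn V θ * alexanderSgn U θ),
      signatureAt U (circlePoint θ) - ε * (1 + alexanderSgn V θ * alexanderSgn U θ), ?_, ?_,
      by ring⟩
    · refine tendsto_const_nhds.congr' ?_
      filter_upwards [nhdsWithin_le_nhds key, self_mem_nhdsWithin] with φ hφ hlt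
      rw [hφ (ne_of_gt hlt), sign_pos (sub_pos.2 hlt), hsV, hsU, SignType.coe_one]
      ring
    · refine tendsto_const_nhds.congr' ?_
      filter_upwards [nhdsWithin_le_nhds key, self_mem_nhdsWithin] with φ hφ hlt
      rw [hφ (ne_of_lt hlt), sign_neg (sub_neg.2 hlt), hsV, hsU, SignType.coe_neg, SignType.coe_one]
      ring
  · rw [hsV, hsU]
    rcases unit _ hd0 with h | h <;> rcases unit _ hgood' with h' | h' <;> simp [h, h']

theorem alexanderSgn_congr {k : ℕ} {V : Matrix (Fin m) (Fin m) ℤ} {W : Matrix (Fin k) (Fin k) ℤ}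
    (h : SEquivalent V W) (θ : ℝ) : alexanderSgn V θ = alexanderSgn W θ := by
  unfold alexanderSgn
  congr 1
  funext φ
  rw [h.invariants.2.1 _ (circlePoint_ne_zero φ)]

end Circle

end

/-! ### The jump formula for a crossing change -/

theorem theorem2p6 (D : KnotDiagram) (c : Fin D.n)
    (m : ℕ) (V : Matrix (Fin m) (Fin m) ℤ) (hV : D.IsSeifertMatrix V)
    (k : ℤˣ → ℕ) (W : (δ : ℤˣ) → Matrix (Fin (k δ)) (Fin (k δ)) ℤ)
    (hW : ∀ δ : ℤˣ, (D.resolve c δ).IsSeifertMatrix (W δ))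
    (hsimple : HasSimpleCircleRoots V)
    (θ : ℝ) (hroot : alexander V (circlePoint θ) = 0)
    (hgood : alexander (W (-D.sign c)) (circlePoint θ) ≠ 0) :
    HasJump (signatureAt V) θ
        (2 * (D.sign c : ℤ) * alexanderSgn (W 1) θ * alexanderSgn (W (-1)) θ) ∧
      2 * (D.sign c : ℤ) * alexanderSgn (W 1) θ * alexanderSgn (W (-1)) θ ∈ ({-2, 2} : Set ℤ) := by
  obtain ⟨m₀, V₀, hV₀, hVV⟩ := hV
  obtain ⟨f, hU⟩ := hV₀.crossingChange c
  set U := V₀ + (D.sign c : ℤ) • Matrix.vecMulVec f f with hUdef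
  have hsame : ∀ δ, δ = D.sign c → SEquivalent V (W δ) := by
    rintro _ rfl
    obtain ⟨n, W₀, hW₀, hWW⟩ := hW (D.sign c)
    rw [D.resolve_sign c] at hW₀
    exact hVV.symm.trans ((hV₀.congruent hW₀).trans hWW)
  have hother : ∀ δ, δ = -D.sign c → SEquivalent U (W δ) := by
    rintro _ rfl
    obtain ⟨n, W₀, hW₀, hWW⟩ := hW (-D.sign c)
    exact (hU.congruent hW₀).trans hWW
  obtain ⟨hpar, hpoly, hsig⟩ := hVV.invariants
  have hm : Even m := hpar.1 hV₀.even
  have h1 := circlePoint_ne_one_of_root V hm hsimple hroot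
  obtain ⟨d, hd0, hd⟩ := exists_hasDerivAt_re_alexander V hm hsimple hroot
  have hroot₀ : alexander V₀ (circlePoint θ) = 0 := by
    rw [hpoly _ (circlePoint_ne_zero θ), hroot]
  -- Simplicity is carried to `V₀` as a nonzero derivative of the invariant function `alexander`;
  -- `alexanderPoly` itself is invariant only up to a power of `t`.
  have hd₀ : HasDerivAt (fun φ => (alexander V₀ (circlePoint φ)).re) d θ := by
    simpa only [hpoly _ (circlePoint_ne_zero _)] using hd
  have hgoodU : alexander U (circlePoint θ) ≠ 0 := by
    rwa [(hother _ rfl).invariants.2.1 _ (circlePoint_ne_zero θ)]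
  obtain ⟨⟨a, b, ha, hb, hab⟩, hpm⟩ :=
    hasJump_of_rank_one V₀ hV₀.even f (D.sign c) h1 hroot₀ hd0 hd₀ hgoodU
  -- The product of the two signs is symmetric, so it does not matter which of `K⁺`, `K⁻` is `K`.
  have hprod : 2 * (D.sign c : ℤ) * alexanderSgn (W 1) θ * alexanderSgn (W (-1)) θ =
      2 * (D.sign c : ℤ) * (alexanderSgn V₀ θ * alexanderSgn U θ) := by
    rw [alexanderSgn_congr hVV]
    rcases Int.units_eq_one_or (D.sign c) with hs | hs
    · rw [alexanderSgn_congr (hsame 1 hs.symm), alexanderSgn_congr (hother (-1) (by rw [hs]))]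
      ring
    · rw [alexanderSgn_congr (hsame (-1) hs.symm),
        alexanderSgn_congr (hother 1 (by rw [hs, neg_neg]))]
      ring
  -- Signatures are compared only for `t ≠ 1`, which holds near `ρ` because `ρ ≠ 1`.
  have hsigeq : ∀ᶠ φ in 𝓝 θ, signatureAt V₀ (circlePoint φ) = signatureAt V (circlePoint φ) := by
    filter_upwards [continuous_circlePoint.continuousAt.eventually_ne h1] with φ hφ
    exact hsig _ hφ
  rw [← hUdef] at hpm
  rw [hprod]
  refine ⟨⟨a, b, ha.congr' (nhdsWithin_le_nhds hsigeq), hb.congr' (nhdsWithin_le_nhds hsigeq), hab⟩,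
    ?_⟩
  rcases Int.units_eq_one_or (D.sign c) with hs | hs <;> rcases hpm with h | h <;>
    simp [hs, h]
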